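/- Let $d\ge 1$, $I_\pm=\{\pm1,\dots,\pm d\}$, $r(\tau)=\mathrm{sign}(\tau)e_{|\tau|}\in\mathbb Z^d$, $|x|=\max_i|x_i|$ on $\mathbb Z^d$, and let $\mathcal H=\mathbb C^{2d}\otimes\ell^2(\mathbb Z^d)$ have the orthonormal basis $|\tau,x\rangle$, $\tau\in I_\pm$, $x\in\mathbb Z^d$; the rows and columns of matrices in $U(2d)$ are indexed by $I_\pm$. Let $\mu$ be a probability measure on $\mathbb T=\mathbb R/2\pi\mathbb Z$ with $d\mu(\theta)=l(\theta)\,d\theta$, $0\le l\in L^\infty(\mathbb T)$, let $\omega=(\omega_y^\tau)_{y\in\mathbb Z^d,\tau\in I_\pm}$ be i.i.d. with law $\mu$, and let $\mathbb D(\omega)|\tau,y\rangle=e^{i\omega_y^\tau}|\tau,y\rangle$. Let $\pi$ be a permutation of $I_\pm$ such that $\sum_{\tau\in\gamma} r(\tau)=0$ for every cycle $\gamma$ of $\pi$ (fixed points counting as cycles of length one), and let $C_\pi$ be its permutation matrix, $C_\pi|\tau\rangle=|\pi(\tau)\rangle$. For $x\in\mathbb Z^d$ let $\mathcal H_x$ be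 the span of the vectors $\bigl|\pi^t(\tau),\,x+\sum_{k=0}^{t}r(\pi^k(\tau))\bigr\rangle$, where $\tau\in I_\pm$ and $0\le t<m_\tau$, with $m_\tau$ the length of the cycle of $\tau$. For an integer $L\ge 1$ let $\mathcal H^{\Lambda_L}=\sum_{|x|\le L}\mathcal H_x$. For $C\in U(2d)$ let $$U^L_\omega(C)=\mathbb D(\omega)\sum_{y\in\mathbb Z^d,\,\tau\in I_\pm}|\tau\rangle\langle\tau|\,C_y\otimes|y+r(\tau)\rangle\langle y|,\qquad C_y=\begin{cases}C_\pi&\text{if }|y|\in\{L-1,L,L+1\},\\ C&\text{otherwise.}\end{cases}$$ The operator $U^L_\omega(C)$ leaves $\mathcal H^{\Lambda_L}$ invariant; let $U^{\Lambda_L}_\omega(C)$ be its restriction to $\mathcal H^{\Lambda_L}$ and, for $z\in\mathbb C$ with $|z|\ne1$, let $R^{\Lambda_L}_\omega(C,z)=(U^{\Lambda_L}_\omega(C)-z)^{-1}$, an operator on $\mathcal H^{\Lambda_L}$. **Proposition.** For all $s\in(0,1)$, $a\ge0$ and $p>1/(1-s)$ there is a constant $c>0$ (depending only on $d,\mu,\pi,s,a,p$)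 such that, for all integers $L\ge1$, all $C\in U(2d)$ with $\|C-C_\pi\|\le L^{-(2(ap+d)+a/s)}$ (operator norm on $\mathbb C^{2d}$), and all $z\in\mathbb C$ with $|z|\neq1$: the operator $U^{\Lambda_L}_\omega(C)-z$ is invertible for every $\omega$, and for all $|\tau,x\rangle,|\sigma,y\rangle\in\mathcal H^{\Lambda_L}$ with $|x-y|>2$ the random variable $|\langle\tau,x|R^{\Lambda_L}_\omega(C,z)|\sigma,y\rangle|^s$ is integrable, with $$\mathbb E_\omega\bigl(|\langle\tau,x|R^{\Lambda_L}_\omega(C,z)|\sigma,y\rangle|^s\bigr)\le\frac{c}{L^{a}}.$$ -/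

import Mathlib

namespace RandomQuantumWalk

noncomputable section

/-- The label set `I_± = {+1,-1,…,+d,-d}`: the pair `(j, ε)` stands for the signed label
`ε (j+1)`. -/
abbrev Dir (d : ℕ) : Type := Fin d × ℤˣ

/-- The lattice `ℤ^d`. -/
abbrev Site (d : ℕ) : Type := Fin d → ℤ

/-- `r(τ) = sign(τ) e_{|τ|}`. -/
def r {d : ℕ} (τ : Dir d) : Site d := Pi.single τ.1 (τ.2 : ℤ)

/-- The norm `|x| = max_i |x_i|` on `ℤ^d`. -/
def boxNorm {d : ℕ} (x : Site d) : ℕ := Finset.univ.sup fun i => (x i).natAbs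

/-- `ℋ = ℂ^{2d} ⊗ ℓ²(ℤ^d)`, realised as `ℓ²(I_± × ℤ^d)`. -/
abbrev Hilb (d : ℕ) : Type := lp (fun _ : Dir d × Site d => ℂ) 2

/-- The basis vector `|τ, x⟩`. -/
def ket {d : ℕ} (τ : Dir d) (x : Site d) : Hilb d := lp.single 2 (τ, x) (1 : ℂ)

/-- `U(2d)`, with rows and columns indexed by `I_±`. -/
abbrev Coin (d : ℕ) : Type := Matrix.unitaryGroup (Dir d) ℂ

/-- The norm of a matrix as an operator on the Euclidean space `ℂ^{2d}`. -/
def opNorm {d : ℕ} (A : Matrix (Dir d) (Dir d) ℂ) : ℝ := ‖Matrix.toEuclideanCLM (𝕜 := ℂ) A‖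

/-! ### The deterministic walk with site dependent coins and the random phases -/

/-- The coordinates of `𝕊(𝒞)ψ`, where
`𝕊(𝒞) = ∑_{y, τ} P_τ C_y ⊗ |y + r(τ)⟩⟨y|`. -/
def walkFun {d : ℕ} (C : Site d → Coin d) (ψ : Dir d × Site d → ℂ) : Dir d × Site d → ℂ :=
  fun i => ∑ σ, (C (i.2 - r i.1) : Matrix (Dir d) (Dir d) ℂ) i.1 σ * ψ (σ, i.2 - r i.1)

theorem memℓp_walkFun {d : ℕ} (C : Site d → Coin d) (ψ : Hilb d) :
    Memℓp (E := fun _ : Dir d × Site d => ℂ) (walkFun C ψ) 2 := by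
  have h2 : (0 : ℝ) < (2 : ENNReal).toReal := by norm_num
  have hψ : Summable fun i : Dir d × Site d => ‖ψ i‖ ^ (2 : ENNReal).toReal :=
    (memℓp_gen_iff h2).1 (lp.memℓp ψ)
  have key : ∀ σ : Dir d, Memℓp (E := fun _ : Dir d × Site d => ℂ)
      (fun i => (C (i.2 - r i.1) : Matrix (Dir d) (Dir d) ℂ) i.1 σ * ψ (σ, i.2 - r i.1)) 2 := by
    intro σ
    apply memℓp_gen
    have hs : Summable fun i : Dir d × Site d =>
        ‖ψ (σ, i.2 - r i.1)‖ ^ (2 : ENNReal).toReal := by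
      rw [← (Equiv.prodComm (Site d) (Dir d)).summable_iff]
      have h0 : ∀ τ : Dir d, Summable fun x : Site d =>
          ‖ψ (σ, x - r τ)‖ ^ (2 : ENNReal).toReal := by
        intro τ
        refine hψ.comp_injective (i := fun x : Site d => (σ, x - r τ)) ?_
        intro x y hxy
        simpa using hxy
      have h1 : Summable fun i : Dir d × Site d =>
          ‖ψ (σ, i.2 - r i.1)‖ ^ (2 : ENNReal).toReal := by
        rw [summable_prod_of_nonneg (fun i => by positivity)]
        exact ⟨h0, Summable.of_finite⟩
      exact (Equiv.prodComm (Site d) (Dir d)).summable_iff.2 h1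
    refine Summable.of_nonneg_of_le (fun i => by positivity) (fun i => ?_) hs
    refine Real.rpow_le_rpow (norm_nonneg _) ?_ h2.le
    rw [norm_mul]
    exact mul_le_of_le_one_left (norm_nonneg _)
      (entry_norm_bound_of_unitary (C (i.2 - r i.1)).2 _ _)
  exact Memℓp.finsetSum Finset.univ fun σ _ => key σ

/-- The operator `𝕊(𝒞)` on `ℋ`. -/
def walk {d : ℕ} (C : Site d → Coin d) : Hilb d →ₗ[ℂ] Hilb d where
  toFun ψ := ⟨walkFun C ψ, memℓp_walkFun C ψ⟩
  map_add' ψ φ := by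
    ext i
    change walkFun C (ψ + φ : Hilb d) i = walkFun C ψ i + walkFun C φ i
    simp [walkFun, mul_add, Finset.sum_add_distrib]
  map_smul' c ψ := by
    ext i
    change walkFun C (c • ψ : Hilb d) i = c * walkFun C ψ i
    simp [walkFun, Finset.mul_sum, mul_left_comm]

/-- The torus `𝕋 = ℝ / 2πℤ`. -/
abbrev Torus : Type := AddCircle (2 * Real.pi)

instance instFactTwoPiPos : Fact (0 < 2 * Real.pi) := ⟨Real.two_pi_pos⟩

/-- The space `𝕋^{I_± × ℤ^d}` of phase configurations. -/
abbrev Phases (d : ℕ) : Type := Dir d × Site d → Torus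

/-- The phase factor `e^{iθ}`. -/
def phase (θ : Torus) : ℂ := (AddCircle.toCircle θ : ℂ)

theorem norm_phase (θ : Torus) : ‖phase θ‖ = 1 :=
  Circle.norm_coe _

theorem memℓp_diag {d : ℕ} (ω : Phases d) (ψ : Hilb d) :
    Memℓp (E := fun _ : Dir d × Site d => ℂ) (fun i => phase (ω i) * ψ i) 2 := by
  have h := lp.memℓp ψ
  rw [memℓp_gen_iff (by norm_num)] at h ⊢
  simpa [norm_phase] using h

/-- The diagonal operator `𝔻(ω) |τ, y⟩ = e^{i ω_y^τ} |τ, y⟩`. -/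
def diag {d : ℕ} (ω : Phases d) : Hilb d →ₗ[ℂ] Hilb d where
  toFun ψ := ⟨fun i => phase (ω i) * ψ i, memℓp_diag ω ψ⟩
  map_add' ψ φ := by
    ext i
    change phase (ω i) * (ψ + φ : Hilb d) i = phase (ω i) * ψ i + phase (ω i) * φ i
    simp [mul_add]
  map_smul' c ψ := by
    ext i
    change phase (ω i) * (c • ψ : Hilb d) i = c * (phase (ω i) * ψ i)
    simp [mul_left_comm]

theorem walk_ket {d : ℕ} (C : Site d → Coin d) (σ : Dir d) (y : Site d) :
    walk C (ket σ y) =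
      ∑ τ, (C y : Matrix (Dir d) (Dir d) ℂ) τ σ • ket τ (y + r τ) := by
  ext ⟨τ, x⟩
  have hL : (walk C (ket σ y)) (τ, x) =
      if x - r τ = y then (C y : Matrix (Dir d) (Dir d) ℂ) τ σ else 0 := by
    change walkFun C (ket σ y) (τ, x) = _
    simp only [walkFun, ket, lp.single_apply, Pi.single_apply, Prod.mk.injEq]
    split_ifs with h
    · simp [h]
    · simp [h]
  rw [hL, lp.coeFn_sum, Finset.sum_apply]
  simp only [lp.coeFn_smul, Pi.smul_apply, ket, lp.single_apply, Pi.single_apply, Prod.mk.injEq,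
    smul_eq_mul, mul_ite, mul_one, mul_zero]
  rw [Finset.sum_eq_single τ (fun ρ _ hρ => by simp [hρ.symm]) (by simp)]
  simp [sub_eq_iff_eq_add]

theorem diag_ket {d : ℕ} (ω : Phases d) (τ : Dir d) (y : Site d) :
    diag ω (ket τ y) = phase (ω (τ, y)) • ket τ y := by
  ext i
  change phase (ω i) * (ket τ y) i = _
  by_cases h : i = (τ, y)
  · subst h; simp
  · simp [ket, lp.single_apply, h]

/-! ### Permutation coins and the invariant subspaces -/

/-- The permutation matrix `C_π |τ⟩ = |π(τ)⟩`. -/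
def permCoin {d : ℕ} (π : Equiv.Perm (Dir d)) : Coin d :=
  ⟨Matrix.of fun ρ τ => if ρ = π τ then 1 else 0, by
    rw [Matrix.mem_unitaryGroup_iff']
    ext τ τ'
    simp [Matrix.mul_apply, Matrix.one_apply, Matrix.star_apply, eq_comm]⟩

/-- The condition `∑_{s=0}^{m_j-1} r(π_j^s(τ_j)) = 0` for every cycle `π_j` of `π` (a fixed point
being a cycle of length one). -/
def NoDrift {d : ℕ} (π : Equiv.Perm (Dir d)) : Prop :=
  ∀ τ : Dir d, ∑ s ∈ Finset.range (Function.minimalPeriod π τ), r ((π ^ s) τ) = 0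

/-- The vector `|π^t(τ), x + ∑_{s=0}^t r(π^s(τ))⟩`. -/
def cycleKet {d : ℕ} (π : Equiv.Perm (Dir d)) (τ : Dir d) (x : Site d) (t : ℕ) : Hilb d :=
  ket ((π ^ t) τ) (x + ∑ s ∈ Finset.range (t + 1), r ((π ^ s) τ))

/-- `ℋ_x^τ = span {|π^t(τ), x + ∑_{s=0}^t r(π^s(τ))⟩ : t = 0, …, m-1}`, where `m` is the length of
the cycle of `τ`. -/
def cycleSpace {d : ℕ} (π : Equiv.Perm (Dir d)) (τ : Dir d) (x : Site d) :
    Submodule ℂ (Hilb d) :=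
  Submodule.span ℂ (cycleKet π τ x '' Set.Iio (Function.minimalPeriod π τ))

/-- `ℋ_x`, the sum of the `ℋ_x^τ` over all `τ ∈ I_±`. -/
def siteSpace {d : ℕ} (π : Equiv.Perm (Dir d)) (x : Site d) : Submodule ℂ (Hilb d) :=
  ⨆ τ : Dir d, cycleSpace π τ x

/-- `ℋ^{Λ_L}`, the sum of the `ℋ_x` over `|x| ≤ L`. -/
def boxSpace {d : ℕ} (π : Equiv.Perm (Dir d)) (L : ℕ) : Submodule ℂ (Hilb d) :=
  ⨆ x : Site d, ⨆ _ : boxNorm x ≤ L, siteSpace π x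

/-! ### The finite volume restriction -/

/-- The coins of `𝕊^L`: `C_π` where `|x| ∈ {L-1, L, L+1}`, and `C` elsewhere. -/
def boxCoins {d : ℕ} (π : Equiv.Perm (Dir d)) (C : Coin d) (L : ℕ) (x : Site d) : Coin d :=
  if boxNorm x + 1 = L ∨ boxNorm x = L ∨ boxNorm x = L + 1 then permCoin π else C

/-- `U^L_ω(C) = 𝔻(ω) 𝕊^L`. -/
def decoupledWalk {d : ℕ} (π : Equiv.Perm (Dir d)) (C : Coin d) (L : ℕ) (ω : Phases d) :
    Hilb d →ₗ[ℂ] Hilb d :=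
  diag ω ∘ₗ walk (boxCoins π C L)

theorem walk_permCoin_ket {d : ℕ} (π : Equiv.Perm (Dir d)) (C : Site d → Coin d) (σ : Dir d)
    (y : Site d) (h : C y = permCoin π) : walk C (ket σ y) = ket (π σ) (y + r (π σ)) := by
  rw [walk_ket, h]
  simp [permCoin]

theorem cycleKet_mem {d : ℕ} {π : Equiv.Perm (Dir d)} {L : ℕ} {x : Site d} (hx : boxNorm x ≤ L)
    (τ : Dir d) {t : ℕ} (ht : t < Function.minimalPeriod π τ) :
    cycleKet π τ x t ∈ boxSpace π L := by
  have h1 : cycleKet π τ x t ∈ cycleSpace π τ x := Submodule.subset_span ⟨t, ht, rfl⟩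
  have h2 : cycleKet π τ x t ∈ siteSpace π x :=
    (le_iSup (fun τ => cycleSpace π τ x) τ) h1
  exact (le_iSup₂ (f := fun (x : Site d) (_ : boxNorm x ≤ L) => siteSpace π x) x hx) h2

theorem minimalPeriod_pos {d : ℕ} (π : Equiv.Perm (Dir d)) (τ : Dir d) :
    0 < Function.minimalPeriod π τ :=
  Function.minimalPeriod_pos_of_mem_periodicPts
    (Function.Injective.mem_periodicPts π.injective τ)

theorem pow_minimalPeriod {d : ℕ} (π : Equiv.Perm (Dir d)) (τ : Dir d) :
    (π ^ Function.minimalPeriod π τ) τ = τ := by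
  rw [Equiv.Perm.coe_pow]
  exact Function.iterate_minimalPeriod

theorem natAbs_sum_r_le {d : ℕ} (A : Finset (Dir d)) (i : Fin d) :
    ((∑ τ ∈ A, r τ) i).natAbs ≤ 1 := by
  have h : (∑ τ ∈ A, r τ) i =
      (if (i, (1 : ℤˣ)) ∈ A then 1 else 0) - (if (i, (-1 : ℤˣ)) ∈ A then 1 else 0) := by
    have h1 : (∑ τ ∈ A, r τ) i = ∑ τ : Dir d, if τ ∈ A then r τ i else 0 := by
      rw [Finset.sum_apply, Finset.sum_ite_mem, Finset.univ_inter]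
    have hU : (Finset.univ : Finset ℤˣ) = {1, -1} := rfl
    have h2 : ∀ j, j ≠ i → ∑ ε : ℤˣ, (if (j, ε) ∈ A then r (j, ε) i else 0) = 0 := by
      intro j hj
      refine Finset.sum_eq_zero fun ε _ => ?_
      simp [r, hj.symm]
    rw [h1, Fintype.sum_prod_type, Finset.sum_eq_single i (fun j _ hj => h2 j hj) (by simp), hU,
      Finset.sum_pair (by decide)]
    simp only [r, Pi.single_eq_same, Units.val_one, Units.val_neg]
    split_ifs <;> simp
  rw [h]
  split_ifs <;> simp

theorem boxNorm_path_le {d : ℕ} (π : Equiv.Perm (Dir d)) (τ : Dir d) (x : Site d) {t : ℕ}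
    (ht : t < Function.minimalPeriod π τ) :
    boxNorm (x + ∑ s ∈ Finset.range (t + 1), r ((π ^ s) τ)) ≤ boxNorm x + 1 := by
  refine Finset.sup_le fun i _ => ?_
  have hinj : Set.InjOn (fun s : ℕ => (π ^ s) τ) (Finset.range (t + 1) : Set ℕ) := by
    intro a ha b hb hab
    simp only [Finset.coe_range, Set.mem_Iio] at ha hb
    simp only [Equiv.Perm.coe_pow] at hab
    exact Function.iterate_injOn_Iio_minimalPeriod (Set.mem_Iio.2 (by omega))
      (Set.mem_Iio.2 (by omega)) hab
  rw [← Finset.sum_image (f := r) hinj]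
  have h1 := natAbs_sum_r_le ((Finset.range (t + 1)).image fun s : ℕ => (π ^ s) τ) i
  have h2 : (x i).natAbs ≤ boxNorm x :=
    Finset.le_sup (f := fun i => (x i).natAbs) (Finset.mem_univ i)
  rw [Pi.add_apply]
  exact (Int.natAbs_add_le _ _).trans (by omega)

/-- `ℋ^{Λ_L}` is invariant under `U^L_ω(C)`. -/
theorem decoupledWalk_mem {d : ℕ} {π : Equiv.Perm (Dir d)} (hπ : NoDrift π) (C : Coin d) (L : ℕ)
    (ω : Phases d) : ∀ ψ ∈ boxSpace π L, decoupledWalk π C L ω ψ ∈ boxSpace π L := by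
  suffices h : boxSpace π L ≤ (boxSpace π L).comap (decoupledWalk π C L ω) from
    fun ψ hψ => h hψ
  conv_lhs => unfold boxSpace siteSpace cycleSpace
  refine iSup_le fun x => iSup_le fun hx => iSup_le fun τ => Submodule.span_le.2 ?_
  rintro _ ⟨t, ht, rfl⟩
  have ht' : t < Function.minimalPeriod π τ := ht
  simp only [Submodule.comap_coe, Set.mem_preimage, SetLike.mem_coe]
  have hy := boxNorm_path_le π τ x ht'
  have hsub : ∀ σ y, ket σ y ∈ boxSpace π L → diag ω (ket σ y) ∈ boxSpace π L := by
    intro σ y h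
    rw [diag_ket]
    exact Submodule.smul_mem _ _ h
  set y := x + ∑ s ∈ Finset.range (t + 1), r ((π ^ s) τ) with hydef
  have hket : cycleKet π τ x t = ket ((π ^ t) τ) y := rfl
  rw [hket, decoupledWalk, LinearMap.comp_apply]
  by_cases hb : boxNorm y + 1 = L ∨ boxNorm y = L ∨ boxNorm y = L + 1
  · rw [walk_permCoin_ket π _ _ _ (by rw [boxCoins, if_pos hb])]
    apply hsub
    have hstep : ket (π ((π ^ t) τ)) (y + r (π ((π ^ t) τ))) = cycleKet π τ x (t + 1) := by
      rw [cycleKet, Finset.sum_range_succ, hydef, ← add_assoc, pow_succ', Equiv.Perm.mul_apply]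
    rw [hstep]
    rcases Nat.lt_or_ge (t + 1) (Function.minimalPeriod π τ) with h | h
    · exact cycleKet_mem hx τ h
    · have hm : t + 1 = Function.minimalPeriod π τ := by omega
      have : cycleKet π τ x (t + 1) = cycleKet π τ x 0 := by
        rw [cycleKet, cycleKet, hm, Finset.sum_range_succ, hπ τ, pow_minimalPeriod]
        simp
      rw [this]
      exact cycleKet_mem hx τ (minimalPeriod_pos π τ)
  · rw [walk_ket, map_sum]
    refine Submodule.sum_mem _ fun ρ _ => ?_
    rw [map_smul]
    refine Submodule.smul_mem _ _ (hsub _ _ ?_)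
    have : ket ρ (y + r ρ) = cycleKet π ρ y 0 := by simp [cycleKet]
    rw [this]
    exact cycleKet_mem (by omega) ρ (minimalPeriod_pos π ρ)

/-- `U^{Λ_L}_ω(C)`, the restriction of `U^L_ω(C)` to `ℋ^{Λ_L}`. -/
def boxWalk {d : ℕ} {π : Equiv.Perm (Dir d)} (hπ : NoDrift π) (C : Coin d) (L : ℕ)
    (ω : Phases d) : Module.End ℂ (boxSpace π L) :=
  (decoupledWalk π C L ω).restrict (decoupledWalk_mem hπ C L ω)

/-- The resolvent `R^{Λ_L}_ω(C, z) = (U^{Λ_L}_ω(C) - z)⁻¹` on `ℋ^{Λ_L}`. -/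
def boxResolvent {d : ℕ} {π : Equiv.Perm (Dir d)} (hπ : NoDrift π) (C : Coin d) (L : ℕ)
    (ω : Phases d) (z : ℂ) : Module.End ℂ (boxSpace π L) :=
  Ring.inverse (boxWalk hπ C L ω - z • (1 : Module.End ℂ (boxSpace π L)))

/-- The matrix element `⟨φ| R^{Λ_L}_ω(C, z) |ψ⟩` for `φ, ψ ∈ ℋ^{Λ_L}`. -/
def resolventElement {d : ℕ} {π : Equiv.Perm (Dir d)} (hπ : NoDrift π) (C : Coin d) (L : ℕ)
    (ω : Phases d) (z : ℂ) (φ ψ : boxSpace π L) : ℂ :=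
  inner ℂ (φ : Hilb d) (boxResolvent hπ C L ω z ψ : Hilb d)

/-! ### The probability space -/

/-- `dμ(θ) = l(θ) dθ` with `0 ≤ l ∈ L^∞(𝕋)`. -/
def HasBoundedDensity (μ : MeasureTheory.Measure Torus) : Prop :=
  ∃ l : Torus → ℝ, (∀ θ, 0 ≤ l θ) ∧
    MeasureTheory.MemLp l ⊤ MeasureTheory.volume ∧
    μ = MeasureTheory.volume.withDensity fun θ => ENNReal.ofReal (l θ)

/-- The law `ℙ = ⨂_{τ, y} dμ` of the i.i.d. phases. -/
def phaseLaw (d : ℕ) (μ : MeasureTheory.Measure Torus) [MeasureTheory.IsProbabilityMeasure μ] :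
    MeasureTheory.Measure (Phases d) :=
  MeasureTheory.Measure.infinitePi fun _ : Dir d × Site d => μ

end

end RandomQuantumWalk

open RandomQuantumWalk

/-!
Write `V` for the walk without its random phases, so that the evolution is `𝔻(ω) V`.

*A priori bound.* For any unitary `V` the moments of order `t < 1` of the Green function of `𝔻(ω) V`
are bounded uniformly in `V`, `z` and the two sites. By polarization it suffices to bound the
quadratic form of the Cayley transform `(1 + ζ 𝔻(ω) V) (1 - ζ 𝔻(ω) V)⁻¹`, where `ζ` is `z⁻¹` or
`conj z`, at a vector supported on the two sites. Replace `𝔻(ω)` by its product with the operator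
that multiplies by `w` at these sites and by `1` elsewhere. For `‖w‖ ≤ 1` this is a contraction, so
the quadratic form is a holomorphic function `g` of `w` with positive real part, and `g 0` does not
depend on the phases. Since `cos (π t / 2) ‖g‖ ^ t ≤ Re (g ^ t)`, the mean value property of `g ^ t`
bounds the mean of `‖g‖ ^ t` over the unit circle by a multiple of `‖g 0‖ ^ t`. A bounded density
makes averaging over the phases at the two sites comparable to averaging over `w`.

*Perturbation.* With the coin `C_π` the basis vectors run around finite cycles, because no cycle of
`π` drifts; hence that Green function vanishes between sites at distance greater than one. By the
second resolvent identity the Green function of the given walk between two such sites is at most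
`‖C - C_π‖ ∑ ‖a‖ ‖b‖`, a finite sum of products of two Green functions. Writing
`‖G‖ ^ s = ‖G‖ ^ (s - q) ‖G‖ ^ q` and using this estimate in the second factor only gains
`‖C - C_π‖ ^ q` and leaves moments of order `s + q < 1`, which the a priori bound controls.
-/

namespace RandomQuantumWalk

open MeasureTheory Filter Topology ComplexConjugate InnerProductSpace
open scoped lp

noncomputable section

section ProductMeasure

variable {ι : Type*}

section Dependent

variable {X : ι → Type*} [∀ i, MeasurableSpace (X i)] {μ ν : ∀ i, Measure (X i)}
  [∀ i, IsProbabilityMeasure (μ i)] [∀ i, IsProbabilityMeasure (ν i)]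

theorem measurable_update_prod [DecidableEq ι] (i : ι) :
    Measurable fun p : (∀ k, X k) × X i => Function.update p.1 i p.2 := by
  refine measurable_pi_lambda _ fun k => ?_
  by_cases h : k = i
  · subst h
    simpa only [Function.update_self] using measurable_snd
  · simp only [Function.update_of_ne h]
    exact (measurable_pi_apply k).comp measurable_fst

theorem map_update_infinitePi_prod [DecidableEq ι] {i : ι} (h : ∀ k ≠ i, ν k = μ k) :
    ((Measure.infinitePi μ).prod (ν i)).map (fun p => Function.update p.1 i p.2) =
      Measure.infinitePi ν := by
  refine Measure.eq_infinitePi _ fun s t ht => ?_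
  rw [Measure.map_apply (measurable_update_prod i)
    (MeasurableSet.pi s.countable_toSet fun k _ => ht k)]
  have hpre : (fun p : (∀ k, X k) × X i => Function.update p.1 i p.2) ⁻¹' Set.pi s t =
      Set.pi (s.erase i : Finset ι) t ×ˢ (if i ∈ s then t i else Set.univ) := by
    ext ⟨ω, x⟩
    simp only [Set.mem_preimage, Set.mem_pi, Set.mem_prod, Finset.mem_coe, Finset.mem_erase]
    constructor
    · refine fun hω => ⟨fun k hk => by simpa [hk.1] using hω k hk.2, ?_⟩
      split_ifs with hi
      · simpa using hω i hi
      · trivial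
    · rintro ⟨hω, hx⟩ k hk
      by_cases hki : k = i
      · subst hki
        simpa [hk] using hx
      · simpa [hki] using hω k ⟨hki, hk⟩
  rw [hpre, Measure.prod_prod, Measure.infinitePi_pi _ fun k _ => ht k,
    Finset.prod_congr rfl fun k hk => by rw [← h k (Finset.ne_of_mem_erase hk)]]
  split_ifs with hi
  · rw [Finset.prod_erase_mul s (fun k => ν k (t k)) hi]
  · rw [measure_univ, mul_one, Finset.erase_eq_of_notMem hi]

theorem infinitePi_le_smul_of_forall_ne {i : ι} {M : NNReal} (h : ∀ k ≠ i, ν k = μ k)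
    (hM : μ i ≤ M • ν i) : Measure.infinitePi μ ≤ M • Measure.infinitePi ν := by
  classical
  refine Measure.le_iff.2 fun s hs => ?_
  have hs' := measurable_update_prod (X := X) i hs
  rw [← map_update_infinitePi_prod (μ := μ) (ν := μ) (i := i) fun _ _ => rfl,
    ← map_update_infinitePi_prod h, Measure.smul_apply,
    Measure.map_apply (measurable_update_prod i) hs,
    Measure.map_apply (measurable_update_prod i) hs, Measure.prod_apply hs',
    Measure.prod_apply hs', ENNReal.smul_def, smul_eq_mul,
    ← lintegral_const_mul' _ _ ENNReal.coe_ne_top]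
  exact lintegral_mono fun ω => hM _

theorem infinitePi_le_smul {A : Finset ι} {M : NNReal} (h : ∀ k ∉ A, ν k = μ k)
    (hM : ∀ k ∈ A, μ k ≤ M • ν k) :
    Measure.infinitePi μ ≤ M ^ A.card • Measure.infinitePi ν := by
  classical
  induction A using Finset.induction_on generalizing μ with
  | empty =>
    obtain rfl : ν = μ := funext fun k => h k (Finset.notMem_empty k)
    simp
  | insert i A hi ih =>
    have hprob : ∀ k, IsProbabilityMeasure (Function.update μ i (ν i) k) := by
      intro k
      by_cases hk : k = i
      · subst hk
        simpa using inferInstanceAs (IsProbabilityMeasure (ν k))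
      · simpa [hk] using inferInstanceAs (IsProbabilityMeasure (μ k))
    have hne : ∀ k ≠ i, Function.update μ i (ν i) k = μ k := fun k hk =>
      Function.update_of_ne hk _ _
    have hstep : Measure.infinitePi μ ≤ M • Measure.infinitePi (Function.update μ i (ν i)) :=
      infinitePi_le_smul_of_forall_ne hne (by simpa using hM i (Finset.mem_insert_self i A))
    have hrest : Measure.infinitePi (Function.update μ i (ν i)) ≤
        M ^ A.card • Measure.infinitePi ν := by
      refine ih (fun k hk => ?_) fun k hk => ?_
      · by_cases hki : k = i
        · subst hki
          simp
        · rw [hne k hki, h k (by simp [hki, hk])]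
      · rw [hne k (ne_of_mem_of_not_mem hk hi)]
        exact hM k (Finset.mem_insert_of_mem hk)
    rw [Finset.card_insert_of_notMem hi, pow_succ', mul_smul]
    refine hstep.trans (Measure.le_iff'.2 fun s => ?_)
    rw [Measure.smul_apply, Measure.smul_apply, ENNReal.smul_def, ENNReal.smul_def]
    gcongr

end Dependent

section Shift

variable [DecidableEq ι] {G : Type*} [AddGroup G]

/-- Translation by `α` of the coordinates in `A`; for phases, the joint rotation over which the
resolvent is averaged. -/
def shiftOn (A : Finset ι) (α : G) (ω : ι → G) : ι → G :=
  fun k => if k ∈ A then α + ω k else ω k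

variable [MeasurableSpace G] [MeasurableAdd₂ G]

theorem measurable_shiftOn (A : Finset ι) :
    Measurable fun p : G × (ι → G) => shiftOn A p.1 p.2 := by
  refine measurable_pi_lambda _ fun k => ?_
  unfold shiftOn
  split_ifs
  · exact measurable_fst.add ((measurable_pi_apply k).comp measurable_snd)
  · exact (measurable_pi_apply k).comp measurable_snd

theorem map_shiftOn_infinitePi {ν : ι → Measure G} [∀ i, IsProbabilityMeasure (ν i)]
    {A : Finset ι} (hA : ∀ k ∈ A, (ν k).IsAddLeftInvariant) (α : G) :
    (Measure.infinitePi ν).map (shiftOn A α) = Measure.infinitePi ν := by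
  have hmeas : ∀ k, Measurable fun x : G => if k ∈ A then α + x else x := fun k => by
    split_ifs
    exacts [measurable_const_add α, measurable_id]
  refine (Measure.infinitePi_map_pi ν hmeas).trans ?_
  congr 1
  funext k
  by_cases hk : k ∈ A
  · have := hA k hk
    simpa [hk] using map_add_left_eq_self (ν k) α
  · simp [hk]

/-- Replacing the law of the coordinates in `A` by the invariant one costs a factor `M` for each of
them, and then translating those coordinates leaves the integral unchanged. -/
theorem lintegral_infinitePi_le_of_shiftOn {μ ν : Measure G} [IsProbabilityMeasure μ]
    [IsProbabilityMeasure ν] [ν.IsAddLeftInvariant] {M : NNReal} (hM : μ ≤ M • ν)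
    (A : Finset ι) {f : (ι → G) → ENNReal} (hf : Measurable f) {S : ENNReal}
    (hS : ∀ ω, ∫⁻ α, f (shiftOn A α ω) ∂ν ≤ S) :
    ∫⁻ ω, f ω ∂(Measure.infinitePi fun _ : ι => μ) ≤ (M : ENNReal) ^ A.card * S := by
  set ρ : ι → Measure G := fun k => if k ∈ A then ν else μ
  have hρ : ∀ k, IsProbabilityMeasure (ρ k) := fun k => by
    simp only [ρ]
    split_ifs <;> infer_instance
  have hle : Measure.infinitePi (fun _ : ι => μ) ≤ M ^ A.card • Measure.infinitePi ρ :=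
    infinitePi_le_smul (fun k hk => if_neg hk) fun k hk => by simpa [ρ, hk] using hM
  have hinv : ∀ α, ∫⁻ ω, f (shiftOn A α ω) ∂(Measure.infinitePi ρ) =
      ∫⁻ ω, f ω ∂(Measure.infinitePi ρ) := fun α => by
    conv_rhs => rw [← map_shiftOn_infinitePi (ν := ρ) (A := A)
      (fun k hk => by simpa [ρ, hk] using inferInstanceAs ν.IsAddLeftInvariant) α]
    exact (lintegral_map hf ((measurable_shiftOn A).comp measurable_prodMk_left)).symm
  have hS' : ∫⁻ ω, f ω ∂(Measure.infinitePi ρ) ≤ S := calc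
    ∫⁻ ω, f ω ∂(Measure.infinitePi ρ)
      = ∫⁻ α, ∫⁻ ω, f (shiftOn A α ω) ∂(Measure.infinitePi ρ) ∂ν := by
        simp_rw [hinv, lintegral_const, measure_univ, mul_one]
    _ = ∫⁻ ω, ∫⁻ α, f (shiftOn A α ω) ∂ν ∂(Measure.infinitePi ρ) :=
        lintegral_lintegral_swap (hf.comp (measurable_shiftOn A)).aemeasurable
    _ ≤ ∫⁻ _, S ∂(Measure.infinitePi ρ) := lintegral_mono hS
    _ = S := by rw [lintegral_const, measure_univ, mul_one]
  calc ∫⁻ ω, f ω ∂(Measure.infinitePi fun _ : ι => μ)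
      ≤ ∫⁻ ω, f ω ∂(M ^ A.card • Measure.infinitePi ρ) := lintegral_mono' hle le_rfl
    _ = (M : ENNReal) ^ A.card * ∫⁻ ω, f ω ∂(Measure.infinitePi ρ) := by
        rw [lintegral_smul_measure, ENNReal.smul_def, smul_eq_mul, ENNReal.coe_pow]
    _ ≤ (M : ENNReal) ^ A.card * S := by gcongr

end Shift

end ProductMeasure

theorem HasBoundedDensity.exists_le_smul_haar {μ : Measure Torus} [IsProbabilityMeasure μ]
    (hμ : HasBoundedDensity μ) :
    ∃ M : NNReal, 1 ≤ M ∧ μ ≤ M • (AddCircle.haarAddCircle : Measure Torus) := by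
  suffices h : ∃ M : NNReal, μ ≤ M • (AddCircle.haarAddCircle : Measure Torus) by
    obtain ⟨M, hM⟩ := h
    refine ⟨M, ?_, hM⟩
    have huniv := hM Set.univ
    rwa [measure_univ, Measure.smul_apply, measure_univ, ENNReal.smul_def, smul_eq_mul, mul_one,
      ENNReal.one_le_coe_iff] at huniv
  obtain ⟨l, hl0, hl, rfl⟩ := hμ
  have hl_le : (fun θ => ENNReal.ofReal (l θ)) ≤ᵐ[volume] fun _ => eLpNorm l ⊤ volume := by
    filter_upwards [ae_le_eLpNormEssSup (f := l) (μ := (volume : Measure Torus))] with θ hθ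
    rwa [eLpNorm_exponent_top, ← Real.enorm_of_nonneg (hl0 θ)]
  obtain ⟨B, hB⟩ : ∃ B : NNReal, (B : ENNReal) = eLpNorm l ⊤ volume :=
    ⟨_, ENNReal.coe_toNNReal hl.2.ne⟩
  refine ⟨B * Real.toNNReal (2 * Real.pi), (withDensity_mono hl_le).trans (le_of_eq ?_)⟩
  rw [← hB, withDensity_const, AddCircle.volume_eq_smul_haarAddCircle, mul_smul]
  rfl

section PositiveRealPart

variable {t : ℝ}

theorem cos_pi_div_two_mul_pos (ht0 : 0 < t) (ht1 : t < 1) : 0 < Real.cos (Real.pi / 2 * t) :=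
  Real.cos_pos_of_mem_Ioo ⟨by nlinarith [Real.pi_pos], by nlinarith [Real.pi_pos]⟩

theorem norm_rpow_mul_cos_le_re_cpow {w : ℂ} (hw : 0 < w.re) (ht0 : 0 < t) (ht1 : t < 1) :
    ‖w‖ ^ t * Real.cos (Real.pi / 2 * t) ≤ (w ^ (t : ℂ)).re := by
  have hw0 : w ≠ 0 := by
    rintro rfl
    simp at hw
  have hre : (w ^ (t : ℂ)).re = ‖w‖ ^ t * Real.cos (Complex.arg w * t) := by
    rw [Complex.cpow_def_of_ne_zero hw0, Complex.exp_re, Complex.re_mul_ofReal,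
      Complex.im_mul_ofReal, Complex.log_re, Complex.log_im,
      Real.rpow_def_of_pos (norm_pos_iff.2 hw0)]
  rw [hre, ← Real.cos_abs (Complex.arg w * t), abs_mul, abs_of_pos ht0]
  refine mul_le_mul_of_nonneg_left
    (Real.cos_le_cos_of_nonneg_of_le_pi (by positivity) ?_ ?_) (by positivity)
  · nlinarith [Real.pi_pos]
  · exact mul_le_mul_of_nonneg_right (Complex.abs_arg_le_pi_div_two_iff.2 hw.le) ht0.le

theorem circleAverage_norm_rpow_le {g : ℂ → ℂ} {c : ℂ} {R : ℝ}
    (hcont : ContinuousOn g (Metric.closedBall c |R|))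
    (hdiff : ∀ w ∈ Metric.ball c |R|, DifferentiableAt ℂ g w)
    (hre : ∀ w ∈ Metric.closedBall c |R|, 0 < (g w).re) (ht0 : 0 < t) (ht1 : t < 1) :
    Real.circleAverage (fun w => ‖g w‖ ^ t) c R ≤ ‖g c‖ ^ t / Real.cos (Real.pi / 2 * t) := by
  have hpow_cont : ContinuousOn (fun w => g w ^ (t : ℂ)) (Metric.closedBall c |R|) :=
    hcont.cpow_const fun w hw => Or.inl (hre w hw)
  have hmean : Real.circleAverage (fun w => g w ^ (t : ℂ)) c R = g c ^ (t : ℂ) :=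
    circleAverage_of_differentiable_on_off_countable Set.countable_empty hpow_cont fun w hw =>
      (hdiff w hw.1).cpow_const (Or.inl (hre w (Metric.ball_subset_closedBall hw.1)))
  have hpow_sphere := hpow_cont.mono Metric.sphere_subset_closedBall
  have hnorm_int : CircleIntegrable (Real.cos (Real.pi / 2 * t) • fun w => ‖g w‖ ^ t) c R :=
    (((hcont.mono Metric.sphere_subset_closedBall).norm.rpow_const
      fun _ _ => Or.inr ht0.le).const_smul _).circleIntegrable'
  have hre_int : CircleIntegrable (Complex.reCLM ∘ fun w => g w ^ (t : ℂ)) c R :=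
    (Complex.continuous_re.comp_continuousOn hpow_sphere).circleIntegrable'
  rw [le_div_iff₀' (cos_pi_div_two_mul_pos ht0 ht1)]
  calc Real.cos (Real.pi / 2 * t) * Real.circleAverage (fun w => ‖g w‖ ^ t) c R
      = Real.circleAverage (Real.cos (Real.pi / 2 * t) • fun w => ‖g w‖ ^ t) c R :=
        (smul_eq_mul _ _).symm.trans Real.circleAverage_smul.symm
    _ ≤ Real.circleAverage (Complex.reCLM ∘ fun w => g w ^ (t : ℂ)) c R :=
        Real.circleAverage_mono hnorm_int hre_int fun w hw =>
          (mul_comm _ _).trans_le (norm_rpow_mul_cos_le_re_cpow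
            (hre w (Metric.sphere_subset_closedBall hw)) ht0 ht1)
    _ = (g c ^ (t : ℂ)).re := by
        rw [Complex.reCLM.circleAverage_comp_comm hpow_sphere.circleIntegrable', hmean,
          Complex.reCLM_apply]
    _ ≤ ‖g c‖ ^ t := (Complex.re_le_norm _).trans_eq (Complex.norm_cpow_real _ _)

theorem lintegral_ofReal_phase {f : ℂ → ℝ} (hf : ContinuousOn f (Metric.sphere 0 1))
    (hf0 : ∀ w, 0 ≤ f w) :
    ∫⁻ α : Torus, ENNReal.ofReal (f (phase α)) ∂AddCircle.haarAddCircle =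
      ENNReal.ofReal (Real.circleAverage f 0 1) := by
  have hcont : Continuous fun α : Torus => f (phase α) :=
    hf.comp_continuous (continuous_subtype_val.comp AddCircle.continuous_toCircle)
      fun α => by simp [norm_phase]
  rw [← ofReal_integral_eq_lintegral_ofReal
    (hcont.integrable_of_hasCompactSupport (HasCompactSupport.of_compactSpace _))
    (Eventually.of_forall fun α => hf0 _), AddCircle.integral_haarAddCircle, Real.circleAverage_def,
    ← AddCircle.intervalIntegral_preimage (2 * Real.pi) 0, zero_add]
  simp [phase, AddCircle.toCircle_apply_mk, circleMap]

theorem lintegral_enorm_phase_rpow_le {g : ℂ → ℂ}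
    (hg : ∀ w, ‖w‖ ≤ 1 → DifferentiableAt ℂ g w) (hre : ∀ w, ‖w‖ ≤ 1 → 0 < (g w).re)
    (ht0 : 0 < t) (ht1 : t < 1) :
    ∫⁻ α : Torus, ‖g (phase α)‖ₑ ^ t ∂AddCircle.haarAddCircle ≤
      ENNReal.ofReal (‖g 0‖ ^ t / Real.cos (Real.pi / 2 * t)) := by
  have hcont : ContinuousOn g (Metric.closedBall 0 1) := fun w hw =>
    (hg w (mem_closedBall_zero_iff.1 hw)).continuousAt.continuousWithinAt
  simp_rw [← ofReal_norm, ENNReal.ofReal_rpow_of_nonneg (norm_nonneg _) ht0.le]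
  rw [lintegral_ofReal_phase (f := fun w => ‖g w‖ ^ t)
    ((hcont.mono Metric.sphere_subset_closedBall).norm.rpow_const fun _ _ => Or.inr ht0.le)
    fun _ => by positivity]
  refine ENNReal.ofReal_le_ofReal (circleAverage_norm_rpow_le ?_ ?_ ?_ ht0 ht1)
  · rwa [abs_one]
  · exact fun w hw => hg w (mem_ball_zero_iff.1 (abs_one (α := ℝ) ▸ hw)).le
  · exact fun w hw => hre w (mem_closedBall_zero_iff.1 (abs_one (α := ℝ) ▸ hw))

end PositiveRealPart

section Operator

theorem abs_norm_sub_one_mul_norm_le {E : Type*} [NormedAddCommGroup E] [NormedSpace ℂ E]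
    {u v : E} (h : ‖u‖ = ‖v‖) (z : ℂ) : |‖z‖ - 1| * ‖v‖ ≤ ‖z • v - u‖ := calc
  |‖z‖ - 1| * ‖v‖ = |‖z • v‖ - ‖u‖| := by
    rw [norm_smul, h, ← sub_one_mul, abs_mul, abs_norm]
  _ ≤ ‖z • v - u‖ := abs_norm_sub_norm_le _ _

theorem isUnit_sub_smul_one_of_isometric {K : Type*} [NormedAddCommGroup K] [NormedSpace ℂ K]
    [FiniteDimensional ℂ K] {T : Module.End ℂ K} (hT : ∀ v, ‖T v‖ = ‖v‖) {z : ℂ} (hz : ‖z‖ ≠ 1) :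
    IsUnit (T - z • (1 : Module.End ℂ K)) := by
  rw [LinearMap.isUnit_iff_ker_eq_bot, LinearMap.ker_eq_bot']
  intro v hv
  have hTv : z • v - T v = 0 := by
    rw [← neg_sub, neg_eq_zero]
    simpa using hv
  have hle := abs_norm_sub_one_mul_norm_le (hT v) z
  rw [hTv, norm_zero] at hle
  have hpos : 0 < |‖z‖ - 1| := abs_pos.2 (sub_ne_zero.2 hz)
  exact norm_le_zero_iff.1 (nonpos_of_mul_nonpos_right hle hpos)

variable {E : Type*} [NormedAddCommGroup E] [InnerProductSpace ℂ E]
  {K : Submodule ℂ E} [K.HasOrthogonalProjection]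

theorem smul_resolvent_sub {U : E →L[ℂ] E} {z : ℂ} (hz : z ∈ resolventSet ℂ U) (x : E) :
    z • resolvent U z x - U (resolvent U z x) = x := by
  simpa [resolvent, Algebra.algebraMap_eq_smul_one] using
    congrArg (fun A : E →L[ℂ] E => A x) (Ring.mul_inverse_cancel _ hz)

theorem resolvent_smul_sub {U : E →L[ℂ] E} {z : ℂ} (hz : z ∈ resolventSet ℂ U) (x : E) :
    resolvent U z (z • x - U x) = x := by
  simpa [resolvent, Algebra.algebraMap_eq_smul_one] using
    congrArg (fun A : E →L[ℂ] E => A x) (Ring.inverse_mul_cancel _ hz)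

theorem norm_inner_le_sum_norm_inner_self (T : E →L[ℂ] E) (x y : E) :
    ‖inner ℂ x (T y)‖ ≤
      ∑ k : Fin 4, ‖inner ℂ (y + Complex.I ^ (k : ℕ) • x) (T (y + Complex.I ^ (k : ℕ) • x))‖ := by
  have hpol := inner_map_polarization' (T : E →ₗ[ℂ] E) y x
  simp only [ContinuousLinearMap.coe_coe] at hpol
  have hI3 : Complex.I ^ 3 = -Complex.I := Complex.I_pow_three
  have htri : ∀ a b c e : ℂ, ‖(a - b - Complex.I * c + Complex.I * e) / 4‖ ≤
      ‖a‖ + ‖c‖ + ‖b‖ + ‖e‖ := fun a b c e => by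
    have h := norm_add_le (a - b - Complex.I * c) (Complex.I * e)
    have h' := norm_sub_le (a - b) (Complex.I * c)
    have h'' := norm_sub_le a b
    rw [norm_mul, Complex.norm_I, one_mul] at h h'
    rw [norm_div, Complex.norm_ofNat]
    linarith [norm_nonneg (a - b - Complex.I * c + Complex.I * e)]
  rw [norm_inner_symm, hpol]
  refine (htri _ _ _ _).trans_eq ?_
  simp only [Fin.sum_univ_four, norm_inner_symm _ (T _)]
  simp [hI3, sub_eq_add_neg]

/-- The Cayley transform `(1 + T)(1 - T)⁻¹ = 2(1 - T)⁻¹ - 1`, meaningful when `1 - T` is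
invertible. It turns resolvents of contractions into operators with positive real part. -/
def cayley (T : E →L[ℂ] E) : E →L[ℂ] E := (2 : ℂ) • Ring.inverse (1 - T) - 1

theorem one_sub_two_mul_smul_resolvent {U : E →L[ℂ] E} {z : ℂ} (hz : z ≠ 0) :
    1 - (2 * z) • resolvent U z = -cayley (z⁻¹ • U) := by
  have h : z • resolvent U z = Ring.inverse (1 - z⁻¹ • U) := by
    simpa [resolvent, Units.smul_def] using spectrum.units_smul_resolvent_self (r := Units.mk0 z hz)
      (a := U)
  rw [mul_smul, h, cayley, neg_sub]

theorem norm_one_sub_starProjection_add_smul_le {w : ℂ} (hw : ‖w‖ ≤ 1) :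
    ‖1 - K.starProjection + w • K.starProjection‖ ≤ 1 := by
  refine ContinuousLinearMap.opNorm_le_bound _ zero_le_one fun v => ?_
  have hsplit : (1 - K.starProjection + w • K.starProjection) v =
      w • K.starProjection v + Kᗮ.starProjection v := by
    rw [Submodule.starProjection_orthogonal']
    simp [add_comm]
  have horth : inner ℂ (w • K.starProjection v) (Kᗮ.starProjection v) = 0 :=
    Submodule.inner_right_of_mem_orthogonal
      (K.smul_mem w (K.starProjection_apply_mem v)) (Kᗮ.starProjection_apply_mem v)
  rw [one_mul, ← sq_le_sq₀ (norm_nonneg _) (norm_nonneg _), hsplit, sq,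
    norm_add_sq_eq_norm_sq_add_norm_sq_of_inner_eq_zero _ _ horth, ← sq, ← sq,
    Submodule.norm_sq_eq_add_norm_sq_starProjection v K, norm_smul]
  gcongr
  exact mul_le_of_le_one_left (norm_nonneg _) hw

theorem norm_smul_rotation_mul_lt_one {U : E →L[ℂ] E} (hU : ‖U‖ ≤ 1) {ζ w : ℂ} (hζ : ‖ζ‖ < 1)
    (hw : ‖w‖ ≤ 1) : ‖ζ • ((1 - K.starProjection + w • K.starProjection) * U)‖ < 1 := by
  rw [norm_smul]
  exact mul_lt_one_of_nonneg_of_lt_one_left (norm_nonneg ζ) hζ ((norm_mul_le _ _).trans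
    (mul_le_one₀ (norm_one_sub_starProjection_add_smul_le hw) (norm_nonneg _) hU))

variable [CompleteSpace E]

theorem mem_resolventSet_of_mem_unitary {U : E →L[ℂ] E} (hU : U ∈ unitary (E →L[ℂ] E)) {z : ℂ}
    (hz : ‖z‖ ≠ 1) : z ∈ resolventSet ℂ U := by
  by_contra h
  exact hz (mem_sphere_zero_iff_norm.1 (spectrum.subset_circle_of_unitary hU h))

theorem abs_norm_sub_one_mul_norm_resolvent_le {U : E →L[ℂ] E} (hU : U ∈ unitary (E →L[ℂ] E))
    {z : ℂ} (hz : ‖z‖ ≠ 1) (x : E) : |‖z‖ - 1| * ‖resolvent U z x‖ ≤ ‖x‖ := by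
  have h := abs_norm_sub_one_mul_norm_le
    (ContinuousLinearMap.norm_map_of_mem_unitary hU (resolvent U z x)) z
  rwa [smul_resolvent_sub (mem_resolventSet_of_mem_unitary hU hz)] at h

theorem mem_unitary_of_norm_map_of_surjective {T : E →L[ℂ] E} (hT : ∀ x, ‖T x‖ = ‖x‖)
    (hsurj : Function.Surjective T) : T ∈ unitary (E →L[ℂ] E) := by
  have h := (Unitary.linearIsometryEquiv.symm
    (LinearIsometryEquiv.ofSurjective ⟨(T : E →ₗ[ℂ] E), hT⟩ hsurj)).2
  exact h

theorem continuous_resolvent_apply {X : Type*} [TopologicalSpace X] {U : X → E →L[ℂ] E}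
    (hU : ∀ ω, U ω ∈ unitary (E →L[ℂ] E)) (hcont : ∀ x, Continuous fun ω => U ω x) {z : ℂ}
    (hz : ‖z‖ ≠ 1) (x : E) : Continuous fun ω => resolvent (U ω) z x := by
  have hpos : 0 < |‖z‖ - 1| := abs_pos.2 (sub_ne_zero.2 hz)
  refine continuous_iff_continuousAt.2 fun ω₀ => tendsto_iff_norm_sub_tendsto_zero.2 ?_
  set y := resolvent (U ω₀) z x
  have hbound : ∀ ω, ‖resolvent (U ω) z x - y‖ ≤ |‖z‖ - 1|⁻¹ * ‖U ω y - U ω₀ y‖ := fun ω => by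
    have hdiff : resolvent (U ω) z x - y = resolvent (U ω) z (U ω y - U ω₀ y) :=
      congrArg (fun A : E →L[ℂ] E => A x) (spectrum.resolvent_sub_resolvent
        (mem_resolventSet_of_mem_unitary (hU ω) hz) (mem_resolventSet_of_mem_unitary (hU ω₀) hz))
    rw [hdiff, le_inv_mul_iff₀ hpos]
    exact abs_norm_sub_one_mul_norm_resolvent_le (hU ω) hz _
  have hlim : Tendsto (fun ω => |‖z‖ - 1|⁻¹ * ‖U ω y - U ω₀ y‖) (𝓝 ω₀) (𝓝 0) := by
    simpa using (tendsto_iff_norm_sub_tendsto_zero.1 (hcont y).continuousAt).const_mul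
      |‖z‖ - 1|⁻¹
  exact squeeze_zero (fun _ => norm_nonneg _) hbound hlim

theorem inverse_one_sub_apply_sub {T : E →L[ℂ] E} (hT : ‖T‖ < 1) (x : E) :
    Ring.inverse (1 - T) x - T (Ring.inverse (1 - T) x) = x := by
  simpa using congrArg (fun A : E →L[ℂ] E => A x)
    (Ring.mul_inverse_cancel _ (isUnit_one_sub_of_norm_lt_one hT))

theorem re_inner_cayley_pos {T : E →L[ℂ] E} (hT : ‖T‖ < 1) {x : E} (hx : x ≠ 0) :
    0 < (inner ℂ x (cayley T x)).re := by
  obtain ⟨y, hy⟩ : ∃ y, y = Ring.inverse (1 - T) x := ⟨_, rfl⟩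
  have hyx : y - T y = x := hy ▸ inverse_one_sub_apply_sub hT x
  have hcayley : cayley T x = y + T y := by
    rw [cayley, sub_apply, smul_apply, one_apply_eq_self, ← hy, ← hyx, two_smul]
    abel
  have hy0 : y ≠ 0 := by
    rintro rfl
    exact hx (by simpa using hyx.symm)
  have hlt : ‖T y‖ < ‖y‖ := (T.le_opNorm y).trans_lt
    (mul_lt_of_lt_one_left (norm_pos_iff.2 hy0) hT)
  have hre : (inner ℂ x (cayley T x)).re = ‖y‖ ^ 2 - ‖T y‖ ^ 2 := by
    rw [hcayley, ← hyx, inner_sub_left, inner_add_right, inner_add_right]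
    change RCLike.re (_ + _ - (_ + _) : ℂ) = _
    rw [map_sub, map_add, map_add, inner_self_eq_norm_sq, inner_self_eq_norm_sq,
      inner_re_symm (T y) y]
    ring
  rw [hre]
  exact sub_pos.2 (pow_lt_pow_left₀ hlt (norm_nonneg _) two_ne_zero)

theorem norm_le_one_of_mem_unitary {U : E →L[ℂ] E} (hU : U ∈ unitary (E →L[ℂ] E)) : ‖U‖ ≤ 1 :=
  U.opNorm_le_bound zero_le_one fun x => by
    rw [ContinuousLinearMap.norm_map_of_mem_unitary hU, one_mul]

theorem one_sub_two_mul_smul_resolvent_of_mem_unitary {U : E →L[ℂ] E}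
    (hU : U ∈ unitary (E →L[ℂ] E)) {z : ℂ} (hz : ‖z‖ < 1) :
    1 - (2 * z) • resolvent U z = star (cayley (conj z • U)) := by
  have hnorm : ‖conj z • U‖ < 1 := by
    rw [norm_smul, RCLike.norm_conj]
    exact mul_lt_one_of_nonneg_of_lt_one_left (norm_nonneg z) hz
      (norm_le_one_of_mem_unitary hU)
  obtain ⟨N, hN⟩ : ∃ N, N = Ring.inverse (1 - conj z • U) := ⟨_, rfl⟩
  have hstarN : star N * (1 - z • star U) = 1 := by
    simpa [hN] using congrArg star
      (Ring.mul_inverse_cancel _ (isUnit_one_sub_of_norm_lt_one hnorm))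
  have hR : (z • 1 - U) * resolvent U z = 1 := by
    simpa [resolvent, Algebra.algebraMap_eq_smul_one] using
      Ring.mul_inverse_cancel _ (mem_resolventSet_of_mem_unitary hU hz.ne)
  have hstarUR : z • (star U * resolvent U z) - resolvent U z = star U := by
    simpa [mul_sub, sub_mul, ← mul_assoc, Unitary.star_mul_self_of_mem hU] using
      congrArg (star U * ·) hR
  have hW : (1 - z • star U) * (z • resolvent U z - 1) = -1 := by
    rw [eq_neg_iff_add_eq_zero]
    calc (1 - z • star U) * (z • resolvent U z - 1) + 1
        = z • (star U - (z • (star U * resolvent U z) - resolvent U z)) := by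
          simp only [sub_mul, mul_sub, one_mul, mul_one, smul_mul_assoc, mul_smul_comm, smul_sub]
          abel
      _ = 0 := by rw [hstarUR, sub_self, smul_zero]
  have hzR : z • resolvent U z - 1 = -star N := by
    calc z • resolvent U z - 1
        = star N * ((1 - z • star U) * (z • resolvent U z - 1)) := by
          rw [← mul_assoc, hstarN, one_mul]
      _ = -star N := by rw [hW, mul_neg_one]
  rw [cayley, ← hN, star_sub, star_smul, star_one, mul_smul,
    sub_eq_iff_eq_add.1 hzR, star_ofNat]
  rw [smul_add, smul_neg, two_smul ℂ (1 : E →L[ℂ] E)]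
  abel

theorem exists_norm_inner_resolvent_eq_cayley {z : ℂ} (hz : ‖z‖ ≠ 1) :
    ∃ ζ : ℂ, ‖ζ‖ < 1 ∧ ∀ U ∈ unitary (E →L[ℂ] E), ∀ x : E,
      ‖inner ℂ x ((1 - (2 * z) • resolvent U z) x)‖ = ‖inner ℂ x (cayley (ζ • U) x)‖ := by
  rcases lt_or_gt_of_ne hz with hz | hz
  · refine ⟨conj z, by simpa using hz, fun U hU x => ?_⟩
    rw [one_sub_two_mul_smul_resolvent_of_mem_unitary hU hz, ContinuousLinearMap.star_eq_adjoint,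
      ContinuousLinearMap.adjoint_inner_right, norm_inner_symm]
  · refine ⟨z⁻¹, by simpa using inv_lt_one_of_one_lt₀ hz, fun U _ x => ?_⟩
    rw [one_sub_two_mul_smul_resolvent (norm_pos_iff.1 (one_pos.trans hz)), neg_apply,
      inner_neg_right, norm_neg]

theorem differentiableAt_inner_cayley {U : E →L[ℂ] E} (hU : ‖U‖ ≤ 1) (x : E) {ζ w : ℂ}
    (hζ : ‖ζ‖ < 1) (hw : ‖w‖ ≤ 1) :
    DifferentiableAt ℂ (fun w => inner ℂ x
      (cayley (ζ • ((1 - K.starProjection + w • K.starProjection) * U)) x)) w := by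
  have hline : DifferentiableAt ℂ
      (fun w : ℂ => 1 - ζ • ((1 - K.starProjection + w • K.starProjection) * U)) w := by
    fun_prop
  have hinv := (differentiableAt_inverse (𝕜 := ℂ)
    (isUnit_one_sub_of_norm_lt_one (norm_smul_rotation_mul_lt_one hU hζ hw))).comp w hline
  exact (innerSL ℂ x).differentiableAt.comp w
    (((hinv.const_smul (2 : ℂ)).sub_const 1).clm_apply (differentiableAt_const x))

theorem inner_cayley_self_of_forall_inner_eq_zero {T : E →L[ℂ] E} (hT : ‖T‖ < 1) {x : E}
    (hx : ∀ y, inner ℂ x (T y) = 0) : inner ℂ x (cayley T x) = inner ℂ x x := by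
  have hinv : inner ℂ x (Ring.inverse (1 - T) x) = inner ℂ x x := by
    simpa only [inner_sub_right, hx, sub_zero] using
      congrArg (inner ℂ x) (inverse_one_sub_apply_sub hT x)
  rw [cayley, sub_apply, smul_apply, one_apply_eq_self, inner_sub_right, inner_smul_right, hinv]
  ring

theorem lintegral_inner_cayley_rpow_le {U : E →L[ℂ] E} (hU : ‖U‖ ≤ 1) {x : E} (hx : x ∈ K)
    {ζ : ℂ} (hζ : ‖ζ‖ < 1) {t : ℝ} (ht0 : 0 < t) (ht1 : t < 1) :
    ∫⁻ α : Torus, ‖inner ℂ x (cayley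
        (ζ • ((1 - K.starProjection + phase α • K.starProjection) * U)) x)‖ₑ ^ t
          ∂AddCircle.haarAddCircle ≤
      ENNReal.ofReal ((‖x‖ ^ 2) ^ t / Real.cos (Real.pi / 2 * t)) := by
  rcases eq_or_ne x 0 with rfl | hx0
  · simp [ht0]
  have horth : ∀ y, inner ℂ x
      ((ζ • ((1 - K.starProjection + (0 : ℂ) • K.starProjection) * U)) y) = 0 := fun y => by
    simp [← Submodule.inner_starProjection_left_eq_right,
      Submodule.starProjection_eq_self_iff.2 hx]
  have hzero : ‖inner ℂ x (cayley
      (ζ • ((1 - K.starProjection + (0 : ℂ) • K.starProjection) * U)) x)‖ = ‖x‖ ^ 2 := by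
    rw [inner_cayley_self_of_forall_inner_eq_zero
      (norm_smul_rotation_mul_lt_one hU hζ (norm_zero.trans_le zero_le_one)) horth,
      inner_self_eq_norm_sq_to_K, norm_pow, RCLike.norm_ofReal, abs_norm]
  refine (lintegral_enorm_phase_rpow_le
    (fun w hw => differentiableAt_inner_cayley hU x hζ hw)
    (fun w hw => re_inner_cayley_pos (norm_smul_rotation_mul_lt_one hU hζ hw) hx0)
    ht0 ht1).trans_eq ?_
  rw [hzero]

end Operator

section RandomPhases

variable {ι : Type*}

theorem hasSum_norm_sq (ψ : ℓ²(ι, ℂ)) : HasSum (fun i => ‖ψ i‖ ^ 2) (‖ψ‖ ^ 2) := by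
  simpa using lp.hasSum_norm (p := 2) (by norm_num) ψ

theorem memℓp_phase_mul (ω : ι → Torus) (ψ : ℓ²(ι, ℂ)) :
    Memℓp (E := fun _ : ι => ℂ) (fun i => phase (ω i) * ψ i) 2 :=
  (memℓp_gen_iff (by norm_num)).2 (by
    simpa [norm_phase] using (memℓp_gen_iff (by norm_num)).1 (lp.memℓp ψ))

/-- Multiplication by the phases `e^{iω_k}` on `ℓ²`: the operator `𝔻(ω)` over any index set. -/
def phaseMul (ω : ι → Torus) : ℓ²(ι, ℂ) →ₗᵢ[ℂ] ℓ²(ι, ℂ) where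
  toFun ψ := ⟨fun i => phase (ω i) * ψ i, memℓp_phase_mul ω ψ⟩
  map_add' ψ φ := by
    ext i
    exact mul_add _ _ _
  map_smul' c ψ := by
    ext i
    exact mul_left_comm _ _ _
  norm_map' ψ := by
    rw [← sq_eq_sq₀ (norm_nonneg _) (norm_nonneg _)]
    refine (hasSum_norm_sq _).unique ?_
    simpa [norm_phase] using hasSum_norm_sq ψ

theorem phaseMul_apply (ω : ι → Torus) (ψ : ℓ²(ι, ℂ)) (i : ι) :
    phaseMul ω ψ i = phase (ω i) * ψ i := rfl

theorem phase_add (α β : Torus) : phase (α + β) = phase α * phase β := by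
  rw [phase, AddCircle.toCircle_add, Circle.coe_mul, phase, phase]

theorem phaseMul_surjective (ω : ι → Torus) : Function.Surjective (phaseMul ω) := fun ψ =>
  ⟨phaseMul (-ω) ψ, by
    ext i
    rw [phaseMul_apply, phaseMul_apply, ← mul_assoc, ← phase_add, Pi.neg_apply, add_neg_cancel,
      phase, AddCircle.toCircle_zero, Circle.coe_one, one_mul]⟩

theorem phaseMul_mem_unitary (ω : ι → Torus) :
    (phaseMul ω).toContinuousLinearMap ∈ unitary (ℓ²(ι, ℂ) →L[ℂ] ℓ²(ι, ℂ)) :=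
  mem_unitary_of_norm_map_of_surjective (phaseMul ω).norm_map (phaseMul_surjective ω)

theorem continuous_phase : Continuous phase :=
  continuous_subtype_val.comp AddCircle.continuous_toCircle

theorem continuous_phaseMul_apply (ψ : ℓ²(ι, ℂ)) :
    Continuous fun ω : ι → Torus => phaseMul ω ψ := by
  refine continuous_iff_continuousAt.2 fun ω₀ => tendsto_iff_norm_sub_tendsto_zero.2 ?_
  have hterm : ∀ i (ω : ι → Torus), ‖(phaseMul ω ψ - phaseMul ω₀ ψ) i‖ ^ 2 ≤ 4 * ‖ψ i‖ ^ 2 := by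
    intro i ω
    have h : ‖(phaseMul ω ψ - phaseMul ω₀ ψ) i‖ ≤ ‖ψ i‖ + ‖ψ i‖ := by
      refine (norm_sub_le _ _).trans_eq ?_
      rw [phaseMul_apply, phaseMul_apply, norm_mul, norm_mul, norm_phase, norm_phase, one_mul]
    calc ‖(phaseMul ω ψ - phaseMul ω₀ ψ) i‖ ^ 2 ≤ (‖ψ i‖ + ‖ψ i‖) ^ 2 := by gcongr
      _ = 4 * ‖ψ i‖ ^ 2 := by ring
  have hcont : Continuous fun ω : ι → Torus => ∑' i, ‖(phaseMul ω ψ - phaseMul ω₀ ψ) i‖ ^ 2 := by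
    refine continuous_tsum (fun i => ?_) ((hasSum_norm_sq ψ).summable.mul_left 4)
      fun i ω => by simpa using hterm i ω
    have hi := (continuous_phase.comp (continuous_apply (A := fun _ => Torus) i)).mul_const (ψ i)
    exact (hi.sub continuous_const).norm.pow 2
  have hsq : Tendsto (fun ω : ι → Torus => ‖phaseMul ω ψ - phaseMul ω₀ ψ‖ ^ 2) (𝓝 ω₀) (𝓝 0) := by
    have h := hcont.tendsto ω₀
    simp only [(hasSum_norm_sq _).tsum_eq] at h
    simpa using h
  simpa using hsq.sqrt

theorem measurable_inner_resolvent_phaseMul [Countable ι] {V : ℓ²(ι, ℂ) →L[ℂ] ℓ²(ι, ℂ)}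
    (hV : V ∈ unitary (ℓ²(ι, ℂ) →L[ℂ] ℓ²(ι, ℂ))) {z : ℂ} (hz : ‖z‖ ≠ 1) (φ ψ : ℓ²(ι, ℂ)) :
    Measurable fun ω : ι → Torus =>
      inner ℂ φ (resolvent ((phaseMul ω).toContinuousLinearMap * V) z ψ) :=
  (continuous_const.inner (continuous_resolvent_apply
    (fun ω => mul_mem (phaseMul_mem_unitary ω) hV)
    (fun x => continuous_phaseMul_apply (V x)) hz ψ)).measurable

theorem measurable_inner_one_sub_smul_resolvent_phaseMul [Countable ι]
    {V : ℓ²(ι, ℂ) →L[ℂ] ℓ²(ι, ℂ)} (hV : V ∈ unitary (ℓ²(ι, ℂ) →L[ℂ] ℓ²(ι, ℂ))) {z : ℂ}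
    (hz : ‖z‖ ≠ 1) (φ : ℓ²(ι, ℂ)) :
    Measurable fun ω : ι → Torus => inner ℂ φ ((1 - (2 * z) •
      resolvent ((phaseMul ω).toContinuousLinearMap * V) z) φ) := by
  simp only [sub_apply, smul_apply, one_apply_eq_self, inner_sub_right, inner_smul_right]
  exact ((measurable_inner_resolvent_phaseMul hV hz φ φ).const_mul _).const_sub _

/-- The vectors of `ℓ²` which vanish outside `A`. -/
def supportedOn (A : Finset ι) : Submodule ℂ ℓ²(ι, ℂ) where
  carrier := {ψ | ∀ i ∉ A, ψ i = 0}
  add_mem' hψ hφ i hi := by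
    rw [lp.coeFn_add, Pi.add_apply, hψ i hi, hφ i hi, add_zero]
  zero_mem' _ _ := rfl
  smul_mem' c ψ hψ i hi := by
    rw [lp.coeFn_smul, Pi.smul_apply, hψ i hi, smul_zero]

theorem sum_single_apply [DecidableEq ι] (A : Finset ι) (ψ : ℓ²(ι, ℂ)) (i : ι) :
    (∑ k ∈ A, lp.single 2 k (ψ k) : ℓ²(ι, ℂ)) i = if i ∈ A then ψ i else 0 := by
  rw [lp.coeFn_sum, Finset.sum_apply]
  simp [lp.single_apply, Pi.single_apply]

theorem sum_single_mem_supportedOn [DecidableEq ι] (A : Finset ι) (ψ : ℓ²(ι, ℂ)) :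
    (∑ k ∈ A, lp.single 2 k (ψ k) : ℓ²(ι, ℂ)) ∈ supportedOn A := fun i hi => by
  rw [sum_single_apply, if_neg hi]

theorem sub_sum_single_mem_supportedOn_orthogonal [DecidableEq ι] (A : Finset ι) (ψ : ℓ²(ι, ℂ)) :
    ψ - ∑ k ∈ A, lp.single 2 k (ψ k) ∈ (supportedOn A)ᗮ := fun φ hφ => by
  rw [lp.inner_eq_tsum]
  refine (tsum_congr fun i => ?_).trans tsum_zero
  rw [lp.coeFn_sub, Pi.sub_apply, sum_single_apply]
  split_ifs with hi
  · rw [sub_self, inner_zero_right]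
  · rw [hφ i hi, inner_zero_left]

instance hasOrthogonalProjection_supportedOn (A : Finset ι) :
    (supportedOn A).HasOrthogonalProjection := by
  classical
  exact ⟨fun ψ =>
    ⟨_, sum_single_mem_supportedOn A ψ, sub_sum_single_mem_supportedOn_orthogonal A ψ⟩⟩

theorem starProjection_supportedOn_apply [DecidableEq ι] (A : Finset ι) (ψ : ℓ²(ι, ℂ)) (i : ι) :
    (supportedOn A).starProjection ψ i = if i ∈ A then ψ i else 0 := by
  rw [Submodule.eq_starProjection_of_mem_orthogonal (sum_single_mem_supportedOn A ψ)
    (sub_sum_single_mem_supportedOn_orthogonal A ψ), sum_single_apply]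

theorem phaseMul_shiftOn [DecidableEq ι] (A : Finset ι) (α : Torus) (ω : ι → Torus) :
    (phaseMul (shiftOn A α ω)).toContinuousLinearMap =
      (1 - (supportedOn A).starProjection + phase α • (supportedOn A).starProjection) *
        (phaseMul ω).toContinuousLinearMap := by
  ext ψ i
  change phase (shiftOn A α ω i) * ψ i = phaseMul ω ψ i -
    (supportedOn A).starProjection (phaseMul ω ψ) i +
      phase α * (supportedOn A).starProjection (phaseMul ω ψ) i
  rw [starProjection_supportedOn_apply, phaseMul_apply, shiftOn]
  split_ifs
  · rw [phase_add]
    ring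
  · ring

theorem lintegral_inner_resolvent_phaseMul_rpow_le [Countable ι] {μ : Measure Torus}
    [IsProbabilityMeasure μ] {M : NNReal} (hM : μ ≤ M • (AddCircle.haarAddCircle : Measure Torus))
    {V : ℓ²(ι, ℂ) →L[ℂ] ℓ²(ι, ℂ)} (hV : V ∈ unitary (ℓ²(ι, ℂ) →L[ℂ] ℓ²(ι, ℂ))) {z : ℂ}
    (hz : ‖z‖ ≠ 1) {A : Finset ι} {φ : ℓ²(ι, ℂ)} (hφ : φ ∈ supportedOn A) {t : ℝ} (ht0 : 0 < t)
    (ht1 : t < 1) :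
    ∫⁻ ω, ‖inner ℂ φ ((1 - (2 * z) •
        resolvent ((phaseMul ω).toContinuousLinearMap * V) z) φ)‖ₑ ^ t
          ∂(Measure.infinitePi fun _ : ι => μ) ≤
      (M : ENNReal) ^ A.card * ENNReal.ofReal ((‖φ‖ ^ 2) ^ t / Real.cos (Real.pi / 2 * t)) := by
  classical
  refine lintegral_infinitePi_le_of_shiftOn hM A ?_ fun ω => ?_
  · exact (measurable_inner_one_sub_smul_resolvent_phaseMul hV hz φ).enorm.pow_const t
  · obtain ⟨ζ, hζ, hcayley⟩ := exists_norm_inner_resolvent_eq_cayley (E := ℓ²(ι, ℂ)) hz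
    have hunit : ∀ ω : ι → Torus, (phaseMul ω).toContinuousLinearMap * V ∈
        unitary (ℓ²(ι, ℂ) →L[ℂ] ℓ²(ι, ℂ)) := fun ω => mul_mem (phaseMul_mem_unitary ω) hV
    simp_rw [← ofReal_norm, hcayley _ (hunit _), ofReal_norm, phaseMul_shiftOn, mul_assoc]
    exact lintegral_inner_cayley_rpow_le (norm_le_one_of_mem_unitary (hunit ω)) hφ hζ ht0 ht1

variable [DecidableEq ι]

/-- The vectors `|j⟩ + iᵏ|i⟩` by which polarization expresses the matrix element `⟨i| T |j⟩`
through quadratic forms. -/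
def polarVec (i j : ι) (k : Fin 4) : ℓ²(ι, ℂ) :=
  lp.single 2 j (1 : ℂ) + Complex.I ^ (k : ℕ) • lp.single 2 i (1 : ℂ)

theorem polarVec_mem_supportedOn (i j : ι) (k : Fin 4) : polarVec i j k ∈ supportedOn {i, j} := by
  intro l hl
  simp only [Finset.mem_insert, Finset.mem_singleton, not_or] at hl
  rw [polarVec, lp.coeFn_add, lp.coeFn_smul, Pi.add_apply, Pi.smul_apply,
    lp.single_apply_ne _ _ _ hl.1, lp.single_apply_ne _ _ _ hl.2, smul_zero, add_zero]

theorem norm_polarVec_le (i j : ι) (k : Fin 4) : ‖polarVec i j k‖ ≤ 2 :=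
  (norm_add_le _ _).trans_eq (by norm_num [norm_smul])

/-- The Green function `⟨i| (z - U)⁻¹ |j⟩`. -/
def green (U : ℓ²(ι, ℂ) →L[ℂ] ℓ²(ι, ℂ)) (z : ℂ) (i j : ι) : ℂ :=
  inner ℂ (lp.single 2 i (1 : ℂ) : ℓ²(ι, ℂ)) (resolvent U z (lp.single 2 j (1 : ℂ)))

theorem norm_green_le {U : ℓ²(ι, ℂ) →L[ℂ] ℓ²(ι, ℂ)}
    (hU : U ∈ unitary (ℓ²(ι, ℂ) →L[ℂ] ℓ²(ι, ℂ))) {z : ℂ} (hz : ‖z‖ ≠ 1) (i j : ι) :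
    ‖green U z i j‖ ≤ ‖inner ℂ (lp.single 2 i (1 : ℂ) : ℓ²(ι, ℂ))
      ((1 - (2 * z) • resolvent U z) (lp.single 2 j (1 : ℂ)))‖ + 2 := by
  set x : ℓ²(ι, ℂ) := lp.single 2 i (1 : ℂ)
  set y : ℓ²(ι, ℂ) := lp.single 2 j (1 : ℂ)
  have hx : ‖x‖ = 1 := by simp [x]
  have hy : ‖y‖ = 1 := by simp [y]
  rcases lt_or_ge ‖z‖ (1 / 2) with hz2 | hz2
  · have hR := abs_norm_sub_one_mul_norm_resolvent_le hU hz y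
    rw [abs_of_neg (by linarith), hy] at hR
    have hG : ‖green U z i j‖ ≤ ‖resolvent U z y‖ :=
      (norm_inner_le_norm (𝕜 := ℂ) x (resolvent U z y)).trans_eq (by rw [hx, one_mul])
    nlinarith [norm_nonneg (inner ℂ x ((1 - (2 * z) • resolvent U z) y)),
      norm_nonneg (resolvent U z y)]
  · have hsplit : 2 * z * green U z i j =
        inner ℂ x y - inner ℂ x ((1 - (2 * z) • resolvent U z) y) := by
      rw [sub_apply, smul_apply, one_apply_eq_self, inner_sub_right, inner_smul_right, green]
      ring
    have hxy : ‖inner ℂ x y‖ ≤ 1 := by simpa [hx, hy] using norm_inner_le_norm (𝕜 := ℂ) x y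
    have hnorm := congrArg norm hsplit
    rw [norm_mul, norm_mul, Complex.norm_ofNat] at hnorm
    have hsub := norm_sub_le (inner ℂ x y) (inner ℂ x ((1 - (2 * z) • resolvent U z) y))
    nlinarith [norm_nonneg (green U z i j)]

theorem enorm_green_le {U : ℓ²(ι, ℂ) →L[ℂ] ℓ²(ι, ℂ)}
    (hU : U ∈ unitary (ℓ²(ι, ℂ) →L[ℂ] ℓ²(ι, ℂ))) {z : ℂ} (hz : ‖z‖ ≠ 1) (i j : ι) :
    ‖green U z i j‖ₑ ≤ ∑ k, ‖inner ℂ (polarVec i j k)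
      ((1 - (2 * z) • resolvent U z) (polarVec i j k))‖ₑ + 2 := by
  have h := ENNReal.ofReal_le_ofReal ((norm_green_le hU hz i j).trans
    (add_le_add_left (norm_inner_le_sum_norm_inner_self _ _ _) 2))
  rw [ENNReal.ofReal_add (by positivity) zero_le_two,
    ENNReal.ofReal_sum_of_nonneg fun _ _ => norm_nonneg _, ENNReal.ofReal_ofNat] at h
  simpa only [ofReal_norm, polarVec] using h

theorem rpow_sum_le_sum_rpow {κ : Type*} (s : Finset κ) (f : κ → ENNReal) {t : ℝ}
    (ht0 : 0 < t) (ht1 : t ≤ 1) : (∑ k ∈ s, f k) ^ t ≤ ∑ k ∈ s, f k ^ t :=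
  Finset.le_sum_of_subadditive (fun x : ENNReal => x ^ t) (ENNReal.zero_rpow_of_pos ht0).le
    (fun x y => ENNReal.rpow_add_le_add_rpow x y ht0.le ht1) s f

theorem enorm_green_rpow_le {U : ℓ²(ι, ℂ) →L[ℂ] ℓ²(ι, ℂ)}
    (hU : U ∈ unitary (ℓ²(ι, ℂ) →L[ℂ] ℓ²(ι, ℂ))) {z : ℂ} (hz : ‖z‖ ≠ 1) (i j : ι) {t : ℝ}
    (ht0 : 0 < t) (ht1 : t ≤ 1) :
    ‖green U z i j‖ₑ ^ t ≤ ∑ k, ‖inner ℂ (polarVec i j k)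
      ((1 - (2 * z) • resolvent U z) (polarVec i j k))‖ₑ ^ t + 2 ^ t :=
  (ENNReal.rpow_le_rpow (enorm_green_le hU hz i j) ht0.le).trans
    ((ENNReal.rpow_add_le_add_rpow _ _ ht0.le ht1).trans
      (add_le_add_left (rpow_sum_le_sum_rpow _ _ ht0 ht1) _))

theorem lintegral_green_phaseMul_rpow_le [Countable ι] {μ : Measure Torus}
    [IsProbabilityMeasure μ] {M : NNReal} (hM1 : 1 ≤ M)
    (hM : μ ≤ M • (AddCircle.haarAddCircle : Measure Torus)) {V : ℓ²(ι, ℂ) →L[ℂ] ℓ²(ι, ℂ)}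
    (hV : V ∈ unitary (ℓ²(ι, ℂ) →L[ℂ] ℓ²(ι, ℂ))) {z : ℂ} (hz : ‖z‖ ≠ 1) (i j : ι) {t : ℝ}
    (ht0 : 0 < t) (ht1 : t < 1) :
    ∫⁻ ω, ‖green ((phaseMul ω).toContinuousLinearMap * V) z i j‖ₑ ^ t
        ∂(Measure.infinitePi fun _ : ι => μ) ≤
      4 * ((M : ENNReal) ^ 2 * ENNReal.ofReal (4 ^ t / Real.cos (Real.pi / 2 * t))) + 2 ^ t := by
  have hquad : ∀ k, ∫⁻ ω, ‖inner ℂ (polarVec i j k) ((1 - (2 * z) •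
      resolvent ((phaseMul ω).toContinuousLinearMap * V) z) (polarVec i j k))‖ₑ ^ t
        ∂(Measure.infinitePi fun _ : ι => μ) ≤
          (M : ENNReal) ^ 2 * ENNReal.ofReal (4 ^ t / Real.cos (Real.pi / 2 * t)) := fun k => by
    have hcos := cos_pi_div_two_mul_pos ht0 ht1
    refine (lintegral_inner_resolvent_phaseMul_rpow_le hM hV hz
      (polarVec_mem_supportedOn i j k) ht0 ht1).trans ?_
    gcongr
    · exact_mod_cast hM1
    · exact Finset.card_le_two
    · nlinarith [norm_polarVec_le i j k, norm_nonneg (polarVec i j k)]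
  refine (lintegral_mono fun ω => enorm_green_rpow_le
    (mul_mem (phaseMul_mem_unitary ω) hV) hz i j ht0 ht1.le).trans ?_
  rw [lintegral_add_right _ measurable_const, lintegral_const, measure_univ, mul_one,
    lintegral_finsetSum _ fun k _ =>
      (measurable_inner_one_sub_smul_resolvent_phaseMul hV hz _).enorm.pow_const t]
  gcongr
  exact (Finset.sum_le_sum fun k _ => hquad k).trans_eq (by simp)

theorem exists_lintegral_green_phaseMul_rpow_le [Countable ι] {μ : Measure Torus}
    [IsProbabilityMeasure μ] (hμ : HasBoundedDensity μ) {t : ℝ} (ht0 : 0 < t) (ht1 : t < 1) :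
    ∃ K : NNReal, ∀ V ∈ unitary (ℓ²(ι, ℂ) →L[ℂ] ℓ²(ι, ℂ)), ∀ z : ℂ, ‖z‖ ≠ 1 → ∀ i j : ι,
      ∫⁻ ω, ‖green ((phaseMul ω).toContinuousLinearMap * V) z i j‖ₑ ^ t
        ∂(Measure.infinitePi fun _ : ι => μ) ≤ K := by
  obtain ⟨M, hM1, hM⟩ := hμ.exists_le_smul_haar
  obtain ⟨K, hK⟩ := WithTop.ne_top_iff_exists.1 (show 4 * ((M : ENNReal) ^ 2 *
    ENNReal.ofReal (4 ^ t / Real.cos (Real.pi / 2 * t))) + 2 ^ t ≠ ⊤ by finiteness)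
  exact ⟨K, fun V hV z hz i j =>
    (lintegral_green_phaseMul_rpow_le hM1 hM hV hz i j ht0 ht1).trans_eq hK.symm⟩

end RandomPhases

section Green

variable {ι : Type*} [DecidableEq ι]

theorem green_eq_apply (U : ℓ²(ι, ℂ) →L[ℂ] ℓ²(ι, ℂ)) (z : ℂ) (i j : ι) :
    green U z i j = resolvent U z (lp.single 2 j 1) i := by
  simp [green, lp.inner_single_left]

theorem hasSum_green_mul (U : ℓ²(ι, ℂ) →L[ℂ] ℓ²(ι, ℂ)) (z : ℂ) (i : ι) (ψ : ℓ²(ι, ℂ)) :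
    HasSum (fun k => green U z i k * ψ k) (resolvent U z ψ i) := by
  have h := (lp.hasSum_single (by norm_num) ψ).mapL
    (innerSL ℂ (lp.single 2 i (1 : ℂ)) ∘L resolvent U z)
  have hterm : ∀ k, (lp.single 2 k (ψ k) : ℓ²(ι, ℂ)) = ψ k • lp.single 2 k (1 : ℂ) := fun k => by
    rw [← lp.single_smul, smul_eq_mul, mul_one]
  simpa [hterm, green, lp.inner_single_left, mul_comm] using h

theorem green_sub_green_eq_sum {U V : ℓ²(ι, ℂ) →L[ℂ] ℓ²(ι, ℂ)} {z : ℂ} (hU : z ∈ resolventSet ℂ U)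
    (hV : z ∈ resolventSet ℂ V) {i : ι} {A : Finset ι} (hA : ∀ k ∉ A, green V z i k = 0) (j : ι) :
    green U z i j - green V z i j =
      ∑ k ∈ A, green V z i k * (U - V) (resolvent U z (lp.single 2 j 1)) k := by
  have h : resolvent U z - resolvent V z = resolvent V z * (U - V) * resolvent U z := by
    rw [← neg_sub, spectrum.resolvent_sub_resolvent hV hU, ← neg_sub U V, mul_neg, neg_mul, neg_neg]
  rw [green_eq_apply, green_eq_apply V]
  refine (congrArg (fun T : ℓ²(ι, ℂ) →L[ℂ] ℓ²(ι, ℂ) => T (lp.single 2 j 1) i) h).trans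
    ((hasSum_green_mul V z i _).unique (hasSum_sum_of_ne_finset_zero fun k hk => ?_))
  rw [hA k hk, zero_mul]

end Green

section Walk

variable {d : ℕ}

theorem sum_norm_sq_mulVec (C : Coin d) (v : Dir d → ℂ) :
    ∑ τ, ‖∑ σ, (C : Matrix (Dir d) (Dir d) ℂ) τ σ * v σ‖ ^ 2 = ∑ σ, ‖v σ‖ ^ 2 := by
  have h := congrArg (· ^ 2) (ContinuousLinearMap.norm_map_of_mem_unitary
    (Unitary.map_mem (Matrix.toEuclideanCLM (n := Dir d) (𝕜 := ℂ)) C.2) (WithLp.toLp 2 v))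
  simpa only [EuclideanSpace.norm_sq_eq, Matrix.ofLp_toEuclideanCLM, Matrix.mulVec, dotProduct]
    using h

theorem ofReal_norm_sq_eq_tsum (ψ : Hilb d) :
    ENNReal.ofReal (‖ψ‖ ^ 2) = ∑ τ, ∑' x, ENNReal.ofReal (‖ψ (τ, x)‖ ^ 2) := by
  rw [← (hasSum_norm_sq ψ).tsum_eq,
    ENNReal.ofReal_tsum_of_nonneg (fun i => by positivity) (hasSum_norm_sq ψ).summable,
    ENNReal.tsum_prod', tsum_fintype]

theorem norm_walk (C : Site d → Coin d) (ψ : Hilb d) : ‖walk C ψ‖ = ‖ψ‖ := by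
  have hshift : ∀ τ : Dir d, ∑' x : Site d, ENNReal.ofReal (‖walk C ψ (τ, x)‖ ^ 2) =
      ∑' y : Site d, ENNReal.ofReal
        (‖∑ σ, (C y : Matrix (Dir d) (Dir d) ℂ) τ σ * ψ (σ, y)‖ ^ 2) := fun τ =>
    (Equiv.subRight (r τ)).tsum_eq fun y : Site d => ENNReal.ofReal
      (‖∑ σ, (C y : Matrix (Dir d) (Dir d) ℂ) τ σ * ψ (σ, y)‖ ^ 2)
  rw [← sq_eq_sq₀ (norm_nonneg _) (norm_nonneg _),
    ← ENNReal.ofReal_eq_ofReal_iff (by positivity) (by positivity), ofReal_norm_sq_eq_tsum,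
    ofReal_norm_sq_eq_tsum]
  simp_rw [hshift]
  rw [← Summable.tsum_finsetSum fun _ _ => ENNReal.summable,
    ← Summable.tsum_finsetSum fun _ _ => ENNReal.summable]
  refine tsum_congr fun y => ?_
  rw [← ENNReal.ofReal_sum_of_nonneg fun _ _ => by positivity,
    ← ENNReal.ofReal_sum_of_nonneg fun _ _ => by positivity,
    sum_norm_sq_mulVec (C y) fun σ => ψ (σ, y)]

/-- The walk `𝕊(𝒞)` as an isometry of `ℋ`. -/
def walkIsometry (C : Site d → Coin d) : Hilb d →ₗᵢ[ℂ] Hilb d := ⟨walk C, norm_walk C⟩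

theorem walk_sum_star_smul_ket (C : Site d → Coin d) (τ : Dir d) (y : Site d) :
    walk C (∑ σ, star ((C y : Matrix (Dir d) (Dir d) ℂ) τ σ) • ket σ y) = ket τ (y + r τ) := by
  have hC : ∀ ρ, ∑ σ, star ((C y : Matrix (Dir d) (Dir d) ℂ) τ σ) *
      (C y : Matrix (Dir d) (Dir d) ℂ) ρ σ = if ρ = τ then 1 else 0 := fun ρ => by
    have h := congrFun (congrFun (Matrix.mem_unitaryGroup_iff.1 (C y).2) ρ) τ
    simpa [Matrix.mul_apply, Matrix.one_apply, mul_comm] using h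
  simp_rw [map_sum, map_smul, walk_ket, Finset.smul_sum, smul_smul]
  rw [Finset.sum_comm]
  simp_rw [← Finset.sum_smul, hC, ite_smul, one_smul, zero_smul]
  simp

theorem walkIsometry_surjective (C : Site d → Coin d) :
    Function.Surjective (walkIsometry C) := by
  intro ψ
  have hclosed : IsClosed (LinearMap.range (walk C) : Set (Hilb d)) :=
    (walkIsometry C).isometry.isClosedEmbedding.isClosed_range
  have hket : ∀ i : Dir d × Site d, (lp.single 2 i (ψ i) : Hilb d) ∈ LinearMap.range (walk C) :=
    fun i => ⟨ψ i • ∑ σ, star ((C (i.2 - r i.1) : Matrix (Dir d) (Dir d) ℂ) i.1 σ) •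
      ket σ (i.2 - r i.1), by
        rw [map_smul, walk_sum_star_smul_ket, sub_add_cancel, ket, ← lp.single_smul, smul_eq_mul,
          mul_one]⟩
  exact hclosed.mem_of_tendsto (lp.hasSum_single (by norm_num) ψ)
    (Eventually.of_forall fun s => Submodule.sum_mem _ fun i _ => hket i)

theorem walkIsometry_mem_unitary (C : Site d → Coin d) :
    (walkIsometry C).toContinuousLinearMap ∈ unitary (Hilb d →L[ℂ] Hilb d) :=
  mem_unitary_of_norm_map_of_surjective (norm_walk C) (walkIsometry_surjective C)

/-- The evolution `𝔻(ω) 𝕊(𝒞)` over one unit of time, as a bounded operator. -/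
def evolution (C : Site d → Coin d) (ω : Phases d) : Hilb d →L[ℂ] Hilb d :=
  (phaseMul ω).toContinuousLinearMap * (walkIsometry C).toContinuousLinearMap

theorem evolution_mem_unitary (C : Site d → Coin d) (ω : Phases d) :
    evolution C ω ∈ unitary (Hilb d →L[ℂ] Hilb d) :=
  mul_mem (phaseMul_mem_unitary ω) (walkIsometry_mem_unitary C)

theorem evolution_apply (C : Site d → Coin d) (ω : Phases d) (ψ : Hilb d) (i : Dir d × Site d) :
    evolution C ω ψ i = phase (ω i) *
      ∑ σ, (C (i.2 - r i.1) : Matrix (Dir d) (Dir d) ℂ) i.1 σ * ψ (σ, i.2 - r i.1) := rfl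

theorem norm_apply_le_opNorm (A : Matrix (Dir d) (Dir d) ℂ) (τ σ : Dir d) :
    ‖A τ σ‖ ≤ opNorm A := by
  set φ := Matrix.toEuclideanCLM (𝕜 := ℂ) A (EuclideanSpace.single σ (1 : ℂ)) with hφ
  calc ‖A τ σ‖ = ‖φ τ‖ := by simp [hφ, Matrix.ofLp_toEuclideanCLM]
    _ ≤ ‖φ‖ := PiLp.norm_apply_le φ τ
    _ ≤ opNorm A := by
      simpa [opNorm] using (Matrix.toEuclideanCLM (𝕜 := ℂ) A).le_opNorm
        (EuclideanSpace.single σ (1 : ℂ))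

theorem norm_evolution_sub_apply_le {C C' : Site d → Coin d} {η : ℝ}
    (hη : ∀ y, opNorm ((C y : Matrix (Dir d) (Dir d) ℂ) -
      (C' y : Matrix (Dir d) (Dir d) ℂ)) ≤ η)
    (ω : Phases d) (ψ : Hilb d) (i : Dir d × Site d) :
    ‖(evolution C ω - evolution C' ω) ψ i‖ ≤ η * ∑ σ, ‖ψ (σ, i.2 - r i.1)‖ := by
  have hdiff : (evolution C ω - evolution C' ω) ψ i = phase (ω i) * ∑ σ,
      ((C (i.2 - r i.1) : Matrix (Dir d) (Dir d) ℂ) -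
        (C' (i.2 - r i.1) : Matrix (Dir d) (Dir d) ℂ)) i.1 σ * ψ (σ, i.2 - r i.1) := by
    simp only [sub_apply, lp.coeFn_sub, Pi.sub_apply, evolution_apply, Matrix.sub_apply, sub_mul,
      Finset.sum_sub_distrib, mul_sub]
  rw [hdiff, norm_mul, norm_phase, one_mul, Finset.mul_sum]
  refine (norm_sum_le _ _).trans (Finset.sum_le_sum fun σ _ => ?_)
  rw [norm_mul]
  gcongr
  exact (norm_apply_le_opNorm _ _ _).trans (hη _)

end Walk

section PermutationCoin

variable {d : ℕ}

/-- The motion `|τ, x⟩ ↦ |π(τ), x + r(π(τ))⟩` of the basis vectors under the walk with coin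
`C_π`. -/
def permStep (π : Equiv.Perm (Dir d)) (i : Dir d × Site d) : Dir d × Site d :=
  (π i.1, i.2 + r (π i.1))

theorem iterate_permStep (π : Equiv.Perm (Dir d)) (i : Dir d × Site d) (n : ℕ) :
    (permStep π)^[n] i =
      ((π ^ n) i.1, i.2 + ∑ k ∈ Finset.range n, r ((π ^ k) (π i.1))) := by
  induction n with
  | zero => simp
  | succ n ih =>
    rw [Function.iterate_succ_apply', ih, permStep, Finset.sum_range_succ, add_assoc, pow_succ',
      Equiv.Perm.mul_apply, ← Equiv.Perm.mul_apply, ← Equiv.Perm.mul_apply, ← pow_succ, ← pow_succ']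

theorem isPeriodicPt_permStep {π : Equiv.Perm (Dir d)} (hπ : NoDrift π) (i : Dir d × Site d) :
    Function.IsPeriodicPt (permStep π) (Function.minimalPeriod π i.1) i := by
  have hperiod := Function.minimalPeriod_apply
    (Function.Injective.mem_periodicPts π.injective i.1)
  have hsum := hπ (π i.1)
  rw [hperiod] at hsum
  rw [Function.IsPeriodicPt, Function.IsFixedPt, iterate_permStep, pow_minimalPeriod, hsum,
    add_zero]

/-- The first `m` iterates of `permStep π`, with `m` the length of the cycle of `π`; when no cycle
of `π` drifts, they form the whole orbit of the basis vector. -/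
def permOrbit (π : Equiv.Perm (Dir d)) (i : Dir d × Site d) : Finset (Dir d × Site d) :=
  (Finset.range (Function.minimalPeriod π i.1)).image fun n => (permStep π)^[n] i

theorem iterate_permStep_mem_permOrbit {π : Equiv.Perm (Dir d)} (hπ : NoDrift π)
    (i : Dir d × Site d) (n : ℕ) : (permStep π)^[n] i ∈ permOrbit π i :=
  Finset.mem_image.2 ⟨n % Function.minimalPeriod π i.1,
    Finset.mem_range.2 (Nat.mod_lt _ (minimalPeriod_pos π i.1)),
    (isPeriodicPt_permStep hπ i).iterate_mod_apply n⟩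

theorem card_permOrbit_le (π : Equiv.Perm (Dir d)) (i : Dir d × Site d) :
    (permOrbit π i).card ≤ Fintype.card (Dir d) :=
  Finset.card_image_le.trans
    ((Finset.card_range _).trans_le Function.minimalPeriod_le_card)

theorem boxNorm_sub_le_of_mem_permOrbit {π : Equiv.Perm (Dir d)} {i j : Dir d × Site d}
    (hj : j ∈ permOrbit π i) : boxNorm (i.2 - j.2) ≤ 1 := by
  obtain ⟨n, hn, rfl⟩ := Finset.mem_image.1 hj
  rw [iterate_permStep]
  cases n with
  | zero => simp [boxNorm]
  | succ n =>
    have hpath := boxNorm_path_le π (π i.1) 0 (t := n) (by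
      rw [Function.minimalPeriod_apply (Function.Injective.mem_periodicPts π.injective i.1)]
      exact Nat.lt_of_succ_lt (Finset.mem_range.1 hn))
    have hzero : boxNorm (0 : Site d) = 0 := Nat.le_zero.1 (Finset.sup_le fun _ _ => by simp)
    rw [hzero] at hpath
    simpa [boxNorm] using hpath

theorem evolution_permCoin_apply_permStep (π : Equiv.Perm (Dir d)) (ω : Phases d) (ψ : Hilb d)
    (i : Dir d × Site d) :
    evolution (fun _ => permCoin π) ω ψ (permStep π i) = phase (ω (permStep π i)) * ψ i := by
  rw [evolution_apply]
  simp [permStep, permCoin]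

theorem green_permCoin_eq_zero {π : Equiv.Perm (Dir d)} (hπ : NoDrift π) (ω : Phases d) {z : ℂ}
    (hz : ‖z‖ ≠ 1) {i j : Dir d × Site d} (hj : j ∉ permOrbit π i) :
    green (evolution (fun _ => permCoin π) ω) z i j = 0 := by
  rw [green_eq_apply]
  set v := resolvent (evolution (fun _ => permCoin π) ω) z (lp.single 2 j 1)
  have hv : z • v - evolution (fun _ => permCoin π) ω v = lp.single 2 j 1 :=
    smul_resolvent_sub (mem_resolventSet_of_mem_unitary (evolution_mem_unitary _ ω) hz) _
  have hstep : ∀ k, permStep π k ≠ j → ‖v k‖ = ‖z‖ * ‖v (permStep π k)‖ := fun k hk => by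
    have h := congrArg (fun ψ : Hilb d => ψ (permStep π k)) hv
    simp only [lp.coeFn_sub, lp.coeFn_smul, Pi.sub_apply, Pi.smul_apply,
      evolution_permCoin_apply_permStep, lp.single_apply_ne _ _ _ hk] at h
    rw [← norm_mul, ← smul_eq_mul, sub_eq_zero.1 h, norm_mul, norm_phase, one_mul]
  have horbit : ∀ n, ‖v i‖ = ‖z‖ ^ n * ‖v ((permStep π)^[n] i)‖ := fun n => by
    induction n with
    | zero => simp
    | succ n ih =>
      have hne : permStep π ((permStep π)^[n] i) ≠ j := fun h =>
        hj (h ▸ Function.iterate_succ_apply' (permStep π) n i ▸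
          iterate_permStep_mem_permOrbit hπ i (n + 1))
      rw [ih, hstep _ hne, Function.iterate_succ_apply', pow_succ, mul_assoc]
  have hcycle := horbit (Function.minimalPeriod π i.1)
  rw [(isPeriodicPt_permStep hπ i).eq] at hcycle
  by_contra h0
  exact hz ((pow_eq_one_iff_of_nonneg (norm_nonneg z) (minimalPeriod_pos π i.1).ne').1
    (mul_right_cancel₀ (norm_ne_zero_iff.2 h0) (by rw [one_mul, ← hcycle])))

theorem norm_green_le_sum {π : Equiv.Perm (Dir d)} (hπ : NoDrift π) {C : Site d → Coin d} {η : ℝ}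
    (hη : ∀ y, opNorm ((C y : Matrix (Dir d) (Dir d) ℂ) -
      (permCoin π : Matrix (Dir d) (Dir d) ℂ)) ≤ η)
    (ω : Phases d) {z : ℂ} (hz : ‖z‖ ≠ 1) {i j : Dir d × Site d} (hij : 1 < boxNorm (i.2 - j.2)) :
    ‖green (evolution C ω) z i j‖ ≤ η * ∑ q ∈ permOrbit π i ×ˢ Finset.univ,
      ‖green (evolution (fun _ => permCoin π) ω) z i q.1‖ *
        ‖green (evolution C ω) z (q.2, q.1.2 - r q.1.1) j‖ := by
  have hj : j ∉ permOrbit π i := fun h => hij.not_ge (boxNorm_sub_le_of_mem_permOrbit h)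
  have hsum := green_sub_green_eq_sum
    (mem_resolventSet_of_mem_unitary (evolution_mem_unitary C ω) hz)
    (mem_resolventSet_of_mem_unitary (evolution_mem_unitary (fun _ => permCoin π) ω) hz)
    (fun k (hk : k ∉ permOrbit π i) => green_permCoin_eq_zero hπ ω hz hk) j
  rw [green_permCoin_eq_zero hπ ω hz hj, sub_zero] at hsum
  rw [hsum, Finset.sum_product, Finset.mul_sum]
  refine (norm_sum_le _ _).trans (Finset.sum_le_sum fun k _ => ?_)
  rw [norm_mul]
  calc _ ≤ ‖green (evolution (fun _ => permCoin π) ω) z i k‖ *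
        (η * ∑ σ, ‖green (evolution C ω) z (σ, k.2 - r k.1) j‖) := by
        gcongr
        simpa only [green_eq_apply] using norm_evolution_sub_apply_le hη ω _ k
    _ = _ := by rw [mul_left_comm, Finset.mul_sum]

end PermutationCoin

section FractionalMoments

theorem rpow_mul_rpow_mul_rpow_le {x a b : ENNReal} {s q : ℝ} (hq0 : 0 ≤ q) (hqs : q ≤ s) :
    x ^ (s - q) * (a ^ q * b ^ q) ≤ x ^ (s + q) + (a ^ (s + q) + b ^ (s + q)) := by
  have hmax : ∀ m : ENNReal, x ≤ m → a ≤ m → b ≤ m →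
      x ^ (s - q) * (a ^ q * b ^ q) ≤ m ^ (s + q) := fun m hx ha hb =>
    calc x ^ (s - q) * (a ^ q * b ^ q) ≤ m ^ (s - q) * (m ^ q * m ^ q) := by gcongr
      _ = m ^ (s + q) := by
        rw [← ENNReal.rpow_add_of_nonneg _ _ hq0 hq0,
          ← ENNReal.rpow_add_of_nonneg _ _ (by linarith) (by linarith)]
        ring_nf
  rcases le_total a b with hab | hab
  · rcases le_total x b with hxb | hxb
    · exact (hmax b hxb hab le_rfl).trans (le_add_left le_add_self)
    · exact (hmax x le_rfl (hab.trans hxb) hxb).trans le_self_add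
  · rcases le_total x a with hxa | hxa
    · exact (hmax a hxa le_rfl hab).trans (le_add_left le_self_add)
    · exact (hmax x le_rfl hxa (hab.trans hxa)).trans le_self_add

theorem rpow_le_mul_sum_of_le_mul_sum {κ : Type*} {A : Finset κ} {x η : ENNReal}
    {a b : κ → ENNReal} (hx : x ≤ η * ∑ k ∈ A, a k * b k) {s q : ℝ} (hq0 : 0 < q) (hqs : q ≤ s)
    (hq1 : q ≤ 1) :
    x ^ s ≤ η ^ q * ∑ k ∈ A, (x ^ (s + q) + (a k ^ (s + q) + b k ^ (s + q))) :=
  calc x ^ s = x ^ (s - q) * x ^ q := by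
        rw [← ENNReal.rpow_add_of_nonneg _ _ (by linarith) hq0.le, sub_add_cancel]
    _ ≤ x ^ (s - q) * (η ^ q * ∑ k ∈ A, (a k * b k) ^ q) := by
        gcongr
        refine (ENNReal.rpow_le_rpow hx hq0.le).trans ?_
        rw [ENNReal.mul_rpow_of_nonneg _ _ hq0.le]
        gcongr
        exact rpow_sum_le_sum_rpow _ _ hq0 hq1
    _ = η ^ q * ∑ k ∈ A, x ^ (s - q) * (a k ^ q * b k ^ q) := by
        simp_rw [ENNReal.mul_rpow_of_nonneg _ _ hq0.le, mul_left_comm _ (η ^ q), Finset.mul_sum]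
    _ ≤ _ := by
        gcongr with k
        exact rpow_mul_rpow_mul_rpow_le hq0.le hqs

theorem lintegral_rpow_le_of_le_mul_sum {Ω κ : Type*} [MeasurableSpace Ω] {P : Measure Ω}
    {A : Finset κ} {x : Ω → ENNReal} {a b : κ → Ω → ENNReal} {η K : ENNReal} {s q : ℝ}
    (hxm : Measurable x) (ham : ∀ k, Measurable (a k)) (hbm : ∀ k, Measurable (b k))
    (hle : ∀ ω, x ω ≤ η * ∑ k ∈ A, a k ω * b k ω)
    (hx : ∫⁻ ω, x ω ^ (s + q) ∂P ≤ K) (ha : ∀ k, ∫⁻ ω, a k ω ^ (s + q) ∂P ≤ K)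
    (hb : ∀ k, ∫⁻ ω, b k ω ^ (s + q) ∂P ≤ K) (hq0 : 0 < q) (hqs : q ≤ s) (hq1 : q ≤ 1) :
    ∫⁻ ω, x ω ^ s ∂P ≤ η ^ q * (A.card * (3 * K)) := by
  have hterm : ∀ k, Measurable fun ω =>
      x ω ^ (s + q) + (a k ω ^ (s + q) + b k ω ^ (s + q)) := by fun_prop
  calc ∫⁻ ω, x ω ^ s ∂P
      ≤ ∫⁻ ω, η ^ q * ∑ k ∈ A, (x ω ^ (s + q) + (a k ω ^ (s + q) + b k ω ^ (s + q))) ∂P :=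
        lintegral_mono fun ω => rpow_le_mul_sum_of_le_mul_sum (hle ω) hq0 hqs hq1
    _ = η ^ q * ∑ k ∈ A, ∫⁻ ω, x ω ^ (s + q) + (a k ω ^ (s + q) + b k ω ^ (s + q)) ∂P := by
        rw [lintegral_const_mul _ (Finset.measurable_fun_sum _ fun k _ => hterm k),
          lintegral_finsetSum _ fun k _ => hterm k]
    _ ≤ η ^ q * ∑ _k ∈ A, 3 * K := by
        gcongr with k
        rw [lintegral_add_left (hxm.pow_const _), lintegral_add_left ((ham k).pow_const _)]
        exact (add_le_add hx (add_le_add (ha k) (hb k))).trans_eq (by ring)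
    _ = η ^ q * (A.card * (3 * K)) := by rw [Finset.sum_const, nsmul_eq_mul]

variable {d : ℕ}

theorem enorm_green_le_sum {π : Equiv.Perm (Dir d)} (hπ : NoDrift π) {C : Site d → Coin d} {η : ℝ}
    (hη : ∀ y, opNorm ((C y : Matrix (Dir d) (Dir d) ℂ) -
      (permCoin π : Matrix (Dir d) (Dir d) ℂ)) ≤ η)
    (ω : Phases d) {z : ℂ} (hz : ‖z‖ ≠ 1) {i j : Dir d × Site d} (hij : 1 < boxNorm (i.2 - j.2)) :
    ‖green (evolution C ω) z i j‖ₑ ≤ ENNReal.ofReal η * ∑ q ∈ permOrbit π i ×ˢ Finset.univ,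
      ‖green (evolution (fun _ => permCoin π) ω) z i q.1‖ₑ *
        ‖green (evolution C ω) z (q.2, q.1.2 - r q.1.1) j‖ₑ := by
  have h := ENNReal.ofReal_le_ofReal (norm_green_le_sum hπ hη ω hz hij)
  rw [ENNReal.ofReal_mul ((norm_nonneg _).trans (hη 0)),
    ENNReal.ofReal_sum_of_nonneg fun _ _ => by positivity] at h
  simpa only [ENNReal.ofReal_mul (norm_nonneg _), ofReal_norm] using h

theorem measurable_green_evolution (C : Site d → Coin d) {z : ℂ} (hz : ‖z‖ ≠ 1)
    (i j : Dir d × Site d) : Measurable fun ω => green (evolution C ω) z i j :=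
  measurable_inner_resolvent_phaseMul (walkIsometry_mem_unitary C) hz _ _

theorem exists_lintegral_green_evolution_rpow_le {μ : Measure Torus} [IsProbabilityMeasure μ]
    (hμ : HasBoundedDensity μ) {π : Equiv.Perm (Dir d)} (hπ : NoDrift π) {s q : ℝ} (hq0 : 0 < q)
    (hqs : q ≤ s) (hsq : s + q < 1) :
    ∃ c : NNReal, ∀ (C : Site d → Coin d) (η : ℝ),
      (∀ y, opNorm ((C y : Matrix (Dir d) (Dir d) ℂ) -
        (permCoin π : Matrix (Dir d) (Dir d) ℂ)) ≤ η) →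
      ∀ z : ℂ, ‖z‖ ≠ 1 → ∀ i j : Dir d × Site d, 1 < boxNorm (i.2 - j.2) →
        ∫⁻ ω, ‖green (evolution C ω) z i j‖ₑ ^ s ∂(phaseLaw d μ) ≤
          ENNReal.ofReal η ^ q * c := by
  obtain ⟨K, hK⟩ := exists_lintegral_green_phaseMul_rpow_le (ι := Dir d × Site d) hμ
    (by linarith : 0 < s + q) hsq
  have hmoment : ∀ (C : Site d → Coin d) (z : ℂ), ‖z‖ ≠ 1 → ∀ i j,
      ∫⁻ ω, ‖green (evolution C ω) z i j‖ₑ ^ (s + q) ∂(phaseLaw d μ) ≤ K :=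
    fun C z hz i j => hK _ (walkIsometry_mem_unitary C) z hz i j
  refine ⟨(Fintype.card (Dir d) * Fintype.card (Dir d) : ℕ) * (3 * K),
    fun C η hη z hz i j hij => ?_⟩
  refine (lintegral_rpow_le_of_le_mul_sum (measurable_green_evolution C hz i j).enorm
    (fun _ => (measurable_green_evolution _ hz _ _).enorm)
    (fun _ => (measurable_green_evolution C hz _ j).enorm)
    (enorm_green_le_sum hπ hη · hz hij) (hmoment C z hz i j) (fun _ => hmoment _ z hz _ _)
    (fun _ => hmoment C z hz _ j) hq0 hqs (by linarith)).trans ?_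
  rw [Finset.card_product, Finset.card_univ]
  push_cast
  gcongr
  exact card_permOrbit_le π i

end FractionalMoments

section FiniteVolume

variable {d : ℕ}

theorem finite_setOf_boxNorm_le (L : ℕ) : {x : Site d | boxNorm x ≤ L}.Finite := by
  refine (Set.Finite.pi' fun _ : Fin d => Set.finite_Icc (-(L : ℤ)) L).subset fun x hx i => ?_
  have h : (x i).natAbs ≤ L :=
    (Finset.le_sup (f := fun i => (x i).natAbs) (Finset.mem_univ i)).trans hx
  rw [Set.mem_Icc]
  omega

instance finiteDimensional_boxSpace (π : Equiv.Perm (Dir d)) (L : ℕ) :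
    FiniteDimensional ℂ (boxSpace π L) := by
  have hbox : boxSpace π L =
      ⨆ x : {x : Site d | boxNorm x ≤ L}, ⨆ τ : Dir d, cycleSpace π τ x := by
    rw [boxSpace, iSup_subtype]
    rfl
  have := (finite_setOf_boxNorm_le (d := d) L).to_subtype
  have hcycle : ∀ (τ : Dir d) (x : Site d), FiniteDimensional ℂ (cycleSpace π τ x) := fun τ x =>
    FiniteDimensional.span_of_finite ℂ ((Set.finite_Iio _).image _)
  rw [hbox]
  infer_instance

variable {π : Equiv.Perm (Dir d)} (hπ : NoDrift π) (C : Coin d) (L : ℕ) (ω : Phases d) {z : ℂ}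

theorem norm_boxWalk_apply (ψ : boxSpace π L) : ‖boxWalk hπ C L ω ψ‖ = ‖ψ‖ := by
  have h : (boxWalk hπ C L ω ψ : Hilb d) = evolution (boxCoins π C L) ω ψ := rfl
  rw [← Submodule.norm_coe, h, ContinuousLinearMap.norm_map_of_mem_unitary
    (evolution_mem_unitary (boxCoins π C L) ω), Submodule.norm_coe]

theorem isUnit_boxWalk_sub_smul (hz : ‖z‖ ≠ 1) :
    IsUnit (boxWalk hπ C L ω - z • (1 : Module.End ℂ (boxSpace π L))) :=
  isUnit_sub_smul_one_of_isometric (norm_boxWalk_apply hπ C L ω) hz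

theorem coe_boxResolvent_apply (hz : ‖z‖ ≠ 1) (ψ : boxSpace π L) :
    (boxResolvent hπ C L ω z ψ : Hilb d) =
      -resolvent (evolution (boxCoins π C L) ω) z (ψ : Hilb d) := by
  set φ := boxResolvent hπ C L ω z ψ
  have h : evolution (boxCoins π C L) ω φ - z • (φ : Hilb d) = ψ :=
    congrArg (fun A : Module.End ℂ (boxSpace π L) => ((A ψ : boxSpace π L) : Hilb d))
      (Ring.mul_inverse_cancel _ (isUnit_boxWalk_sub_smul hπ C L ω hz))
  rw [← h, ← neg_sub, map_neg, neg_neg, resolvent_smul_sub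
    (mem_resolventSet_of_mem_unitary (evolution_mem_unitary (boxCoins π C L) ω) hz)]

theorem resolventElement_eq_neg_green (hz : ‖z‖ ≠ 1) {τ σ : Dir d} {x y : Site d}
    (hx : ket τ x ∈ boxSpace π L) (hy : ket σ y ∈ boxSpace π L) :
    resolventElement hπ C L ω z ⟨ket τ x, hx⟩ ⟨ket σ y, hy⟩ =
      -green (evolution (boxCoins π C L) ω) z (τ, x) (σ, y) := by
  rw [resolventElement, coe_boxResolvent_apply hπ C L ω hz, inner_neg_right]
  rfl

theorem opNorm_boxCoins_sub_permCoin_le (y : Site d) :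
    opNorm ((boxCoins π C L y : Matrix (Dir d) (Dir d) ℂ) -
        (permCoin π : Matrix (Dir d) (Dir d) ℂ)) ≤
      opNorm ((C : Matrix (Dir d) (Dir d) ℂ) - (permCoin π : Matrix (Dir d) (Dir d) ℂ)) := by
  rw [boxCoins]
  split_ifs
  · simp [opNorm]
  · rfl

end FiniteVolume

section Theorem

theorem integrable_norm_rpow_and_integral_le {Ω : Type*} [MeasurableSpace Ω] {P : Measure Ω}
    {f : Ω → ℂ} (hf : Measurable f) {s B : ℝ} (hs : 0 ≤ s) (hB : 0 ≤ B)
    (h : ∫⁻ ω, ‖f ω‖ₑ ^ s ∂P ≤ ENNReal.ofReal B) :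
    Integrable (fun ω => ‖f ω‖ ^ s) P ∧ ∫ ω, ‖f ω‖ ^ s ∂P ≤ B := by
  have hnonneg : 0 ≤ᵐ[P] fun ω => ‖f ω‖ ^ s := Eventually.of_forall fun ω => by positivity
  have hmeas := (hf.norm.pow_const s).aestronglyMeasurable (μ := P)
  simp_rw [← ofReal_norm, ENNReal.ofReal_rpow_of_nonneg (norm_nonneg _) hs] at h
  refine ⟨⟨hmeas, ?_⟩, ?_⟩
  · exact (hasFiniteIntegral_iff_ofReal hnonneg).2 (h.trans_lt ENNReal.ofReal_lt_top)
  · rw [integral_eq_lintegral_of_nonneg_ae hnonneg hmeas]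
    exact ENNReal.toReal_le_of_le_ofReal hB h

theorem mainTheorem4_general {d : ℕ} {μ : Measure Torus} [IsProbabilityMeasure μ]
    (hμ : HasBoundedDensity μ) {π : Equiv.Perm (Dir d)} (hπ : NoDrift π) {s q : ℝ} (hq0 : 0 < q)
    (hqs : q ≤ s) (hsq : s + q < 1) :
    ∃ c : ℝ, 0 < c ∧ ∀ (L : ℕ) (C : Coin d) (z : ℂ), ‖z‖ ≠ 1 →
      (∀ ω : Phases d,
        IsUnit (boxWalk hπ C L ω - z • (1 : Module.End ℂ (boxSpace π L)))) ∧
      ∀ (τ σ : Dir d) (x y : Site d)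
        (hx : ket τ x ∈ boxSpace π L) (hy : ket σ y ∈ boxSpace π L), 1 < boxNorm (x - y) →
        Integrable (fun ω => ‖resolventElement hπ C L ω z ⟨ket τ x, hx⟩ ⟨ket σ y, hy⟩‖ ^ s)
          (phaseLaw d μ) ∧
        ∫ ω, ‖resolventElement hπ C L ω z ⟨ket τ x, hx⟩ ⟨ket σ y, hy⟩‖ ^ s ∂(phaseLaw d μ) ≤
          c * opNorm ((C : Matrix (Dir d) (Dir d) ℂ) -
            (permCoin π : Matrix (Dir d) (Dir d) ℂ)) ^ q := by
  obtain ⟨c, hc⟩ := exists_lintegral_green_evolution_rpow_le hμ hπ hq0 hqs hsq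
  refine ⟨c + 1, by positivity, fun L C z hz =>
    ⟨fun ω => isUnit_boxWalk_sub_smul hπ C L ω hz, fun τ σ x y hx hy hxy => ?_⟩⟩
  have hη : 0 ≤ opNorm ((C : Matrix (Dir d) (Dir d) ℂ) -
    (permCoin π : Matrix (Dir d) (Dir d) ℂ)) := norm_nonneg _
  simp_rw [resolventElement_eq_neg_green hπ C L _ hz hx hy, norm_neg]
  refine integrable_norm_rpow_and_integral_le (measurable_green_evolution _ hz _ _)
    (by linarith) (by positivity) ((hc _ _ (opNorm_boxCoins_sub_permCoin_le C L) z hz _ _ hxy).trans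
      ?_)
  rw [ENNReal.ofReal_rpow_of_nonneg hη hq0.le, ENNReal.ofReal_mul (by positivity), mul_comm]
  gcongr
  rw [← ENNReal.ofReal_coe_nnreal]
  gcongr
  linarith

theorem exists_interpolation_exponent {s a p b : ℝ} (hs0 : 0 < s) (hs1 : s < 1) (ha : 0 ≤ a)
    (hp : 1 / (1 - s) < p) (hb : 0 ≤ b) :
    ∃ q, 0 < q ∧ q ≤ s ∧ s + q < 1 ∧ a ≤ (2 * (a * p + b) + a / s) * q := by
  have h1s : 0 < 1 - s := by linarith
  have hps : 1 < p * (1 - s) := (div_lt_iff₀ h1s).1 hp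
  have hp0 : 0 < p := (one_div_pos.2 h1s).trans hp
  have has : 0 ≤ a / s := by positivity
  rcases le_total s ((1 - s) / 2) with h | h
  · refine ⟨s, hs0, le_rfl, by linarith, ?_⟩
    rw [add_mul, div_mul_cancel₀ _ hs0.ne']
    exact le_add_of_nonneg_left (by positivity)
  · refine ⟨(1 - s) / 2, by linarith, h, by linarith, ?_⟩
    nlinarith [mul_nonneg ha (sub_nonneg.2 hps.le), mul_nonneg hb h1s.le, mul_nonneg has h1s.le]

theorem rpow_le_one_div_rpow {η l κ a q : ℝ} (hη0 : 0 ≤ η) (hη : η ≤ 1 / l ^ κ) (hl : 1 ≤ l)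
    (hq : 0 ≤ q) (haq : a ≤ κ * q) : η ^ q ≤ 1 / l ^ a :=
  calc η ^ q ≤ (1 / l ^ κ) ^ q := Real.rpow_le_rpow hη0 hη hq
    _ = 1 / l ^ (κ * q) := by
      rw [Real.div_rpow zero_le_one (by positivity), Real.one_rpow, ← Real.rpow_mul (by positivity)]
    _ ≤ 1 / l ^ a := by gcongr

end Theorem

end

end RandomQuantumWalk

theorem mainTheorem4 (d : ℕ) (hd : 1 ≤ d)
    (μ : MeasureTheory.Measure Torus) [MeasureTheory.IsProbabilityMeasure μ]
    (hμ : HasBoundedDensity μ)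
    (π : Equiv.Perm (Dir d)) (hπ : NoDrift π)
    (s a p : ℝ) (hs0 : 0 < s) (hs1 : s < 1) (ha : 0 ≤ a) (hp : 1 / (1 - s) < p) :
    ∃ c : ℝ, 0 < c ∧
      ∀ L : ℕ, 1 ≤ L →
      ∀ C : Coin d,
        opNorm ((C : Matrix (Dir d) (Dir d) ℂ) - (permCoin π : Matrix (Dir d) (Dir d) ℂ)) ≤
            1 / (L : ℝ) ^ (2 * (a * p + (d : ℝ)) + a / s) →
      ∀ z : ℂ, ‖z‖ ≠ 1 →
        (∀ ω : Phases d,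
          IsUnit (boxWalk hπ C L ω - z • (1 : Module.End ℂ (boxSpace π L)))) ∧
        ∀ (τ σ : Dir d) (x y : Site d)
          (hx : ket τ x ∈ boxSpace π L) (hy : ket σ y ∈ boxSpace π L),
          2 < boxNorm (x - y) →
          MeasureTheory.Integrable
            (fun ω => ‖resolventElement hπ C L ω z ⟨ket τ x, hx⟩ ⟨ket σ y, hy⟩‖ ^ s)
            (phaseLaw d μ) ∧
          ∫ ω, ‖resolventElement hπ C L ω z ⟨ket τ x, hx⟩ ⟨ket σ y, hy⟩‖ ^ s ∂(phaseLaw d μ)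
            ≤ c / (L : ℝ) ^ a := by
  obtain ⟨q, hq0, hqs, hsq, haq⟩ := exists_interpolation_exponent hs0 hs1 ha hp d.cast_nonneg
  obtain ⟨c, hc0, hc⟩ := mainTheorem4_general hμ hπ hq0 hqs hsq
  refine ⟨c, hc0, fun L hL C hC z hz => (hc L C z hz).imp_right
    fun hdecay τ σ x y hx hy hxy => (hdecay τ σ x y hx hy (by omega)).imp_right fun hle => ?_⟩
  rw [div_eq_mul_one_div]
  exact hle.trans (mul_le_mul_of_nonneg_left
    (rpow_le_one_div_rpow (norm_nonneg _) hC (Nat.one_le_cast.2 hL) hq0.le haq) hc0.le)
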